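/- Let $n\ge 1$. Let $X\subset\mathbb C^n$ be either the unit polydisc $\mathbb D^n$, with $\Gamma_X=\mathbb T^n$, or a bounded complete Reinhardt domain with $C^2$ boundary, with $\Gamma_X=\partial X$; let $d=n$, respectively $d=2n-1$, be the real dimension of $\Gamma_X$ and $\sigma$ the induced Lebesgue ($d$-dimensional surface) measure on $\Gamma_X$. Let $G$ be a finite subgroup of $U(n)$ leaving $X$ and $\Gamma_X$ invariant, let $\Omega\subset\mathbb C^n$ be a bounded domain, and let $\Phi:X\to\Omega$ be a proper surjective holomorphic map which extends smoothly to $\partial X$ and whose fibres on $X$ are exactly the $G$-orbits (so $\Omega\cong X/G$). Put $\Gamma_\Omega=\Phi(\Gamma_X)$, let $m$ be the induced Lebesgue ($d$-dimensional Hausdorff) measure on $\Gamma_\Omega$, and assume that also on $\Gamma_X$ the fibres of $\Phi$ are $G$-orbits, up to a $\sigma$-null set. Let $w\ge 0$ be the $G$-invariant density of the pulled-back surface measure, i.e. $\frac1{|G|}\int_{\Gamma_X\cap\Phi^{-1}(E)}w\,d\sigma=m(E)$ for all Borel $E$. Boundary values are $F^*(z)=\lim_{r\to1^-}F(rz)$,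 and, for $f$ on $\Omega$, $f^*(\Phi(z))=(f\circ\Phi)^*(z)$, $z\in\Gamma_X$. Assume that the quadruple $(X,\Omega,\Phi,G)$ is admissible: there is a $G$-invariant holomorphic function $g$ without zeros on $X$ such that $g^*$ exists and $|g^*|^2=w$ $\sigma$-a.e.; fix such a $g$. For $0<p<\infty$ let $H^p(X)$ be the space of holomorphic $F$ on $X$ with $\sup_{0<r<1}\int_{\Gamma_X}|F(rz)|^p\,d\sigma(z)<\infty$, and let $H^p(\Omega)$ be the space of holomorphic $f$ on $\Omega$ with $$\frac1{|G|}\sup_{0<r<1}\int_{\Gamma_X}|f(\Phi(rz))|^p\,|g(rz)|^2\,d\sigma(z)<\infty .$$ Through boundary values, $H^2(X)$ and $H^2(\Omega)$ are closed subspaces of $L^2(\Gamma_X)=L^2(\sigma)$ and $L^2(\Gamma_\Omega)=L^2(m)$; let $S_X$ and $S_\Omega$ be the orthogonal projections onto them. $H^p(\Omega)$ carries the norm $\|f^*\|_{L^p(\Gamma_\Omega)}$. Theorem B. Let $1<p<\infty$. Then $S_\Omega$ is bounded in the $L^p(\Gamma_\Omega)$-norm, i.e. there is $C<\infty$ with $$\|S_\Omega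 \varphi\|_{L^p(\Gamma_\Omega)}\le C\|\varphi\|_{L^p(\Gamma_\Omega)}\qquad\text{for all }\varphi\in L^2(\Gamma_\Omega)\cap L^p(\Gamma_\Omega),$$ if and only if $S_X$ is bounded on the $G$-invariant functions of $L^p(\Gamma_X,w^{1-p/2})$, i.e. there is $C<\infty$ with $$\|S_X h\|_{L^p(\Gamma_X,w^{1-p/2})}\le C\|h\|_{L^p(\Gamma_X,w^{1-p/2})}\qquad\text{for all $G$-invariant }h\in L^2(\Gamma_X)\cap L^p(\Gamma_X,w^{1-p/2}).$$ The same equivalence holds with the Hardy spaces as target spaces: the first estimate holds and $S_\Omega\varphi$ is the boundary function of an element of $H^2(\Omega)\cap H^p(\Omega)$ for all such $\varphi$, if and only if the second estimate holds and $S_Xh$ is the boundary function of an element of $H^2(X)\cap H^p(X,w^{1-p/2})$ for all such $h$. Here $H^p(X,w^{1-p/2})$ is the space of holomorphic $F$ on $X$ with $\sup_{0<r<1}\int_{\Gamma_X}|F(rz)|^p|g(rz)|^{2-p}\,d\sigma(z)<\infty$. -/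

import Mathlib

open Set Filter Topology MeasureTheory
open scoped ENNReal NNReal ContDiff

/-- Complex Euclidean space `ℂⁿ` with its Hermitian norm. -/
abbrev Cn (n : ℕ) : Type := EuclideanSpace ℂ (Fin n)

/-- The open unit polydisc. -/
def unitPolydisc (n : ℕ) : Set (Cn n) := {z | ∀ j, ‖z j‖ < 1}

/-- The unit torus, i.e. the distinguished boundary of the polydisc. -/
def unitTorus (n : ℕ) : Set (Cn n) := {z | ∀ j, ‖z j‖ = 1}

/-- A complete Reinhardt domain centered at the origin (such a set is automatically connected). -/
def IsCompleteReinhardt {n : ℕ} (X : Set (Cn n)) : Prop :=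
  IsOpen X ∧ X.Nonempty ∧ ∀ z ∈ X, ∀ z' : Cn n, (∀ j, ‖z' j‖ ≤ ‖z j‖) → z' ∈ X

/-- The boundary of `X` is `C²`: near each boundary point `X` is the sublevel set of
a `C²` function with non-vanishing differential. -/
def HasC2Boundary {n : ℕ} (X : Set (Cn n)) : Prop :=
  ∀ q ∈ frontier X, ∃ U : Set (Cn n), IsOpen U ∧ q ∈ U ∧ ∃ ρ : Cn n → ℝ,
    ContDiffOn ℝ 2 ρ U ∧ fderiv ℝ ρ q ≠ 0 ∧ X ∩ U = {z ∈ U | ρ z < 0}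

/-- The pairs `(X, Γ)` under consideration, with `d` the real dimension of `Γ`: either the polydisc
with its distinguished boundary, or a bounded complete Reinhardt domain with `C²` boundary
together with its whole topological boundary. -/
def IsModelPair {n : ℕ} (X Γ : Set (Cn n)) (d : ℕ) : Prop :=
  (X = unitPolydisc n ∧ Γ = unitTorus n ∧ d = n) ∨
  (IsCompleteReinhardt X ∧ Bornology.IsBounded X ∧ HasC2Boundary X ∧
    Γ = frontier X ∧ d = 2 * n - 1)

/-- The induced Lebesgue measure on a `d`-dimensional subset `S` of `ℂⁿ`: the `d`-dimensional
Hausdorff measure (normalised to agree with Lebesgue measure on `ℝᵈ`) restricted to `S`. -/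
noncomputable def inducedMeasure {n : ℕ} (d : ℕ) (S : Set (Cn n)) : Measure (Cn n) :=
  (Measure.euclideanHausdorffMeasure d).restrict S

/-- `F` has the boundary value `l` at `z`: `F (r z) → l` as `r → 1⁻`. -/
def HasBoundaryValue {n : ℕ} (F : Cn n → ℂ) (z : Cn n) (l : ℂ) : Prop :=
  Tendsto (fun r : ℝ => F ((r : ℂ) • z)) (𝓝[<] 1) (𝓝 l)

/-- The quadruple `(X, Ω, Φ, G)`: `Ω` is the quotient of the model domain `X` by the finite group
`G` of unitary maps, realised by the proper holomorphic map `Φ : X → Ω`, which extends smoothly to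
the boundary. `Γ` is the part `Γ_X` of the boundary of `X` on which integrals are taken. -/
structure QuotientQuadruple (n : ℕ) where
  X : Set (Cn n)
  Γ : Set (Cn n)
  /-- the real dimension of `Γ` -/
  d : ℕ
  model : IsModelPair X Γ d
  Ω : Set (Cn n)
  isOpen_Ω : IsOpen Ω
  isConnected_Ω : IsConnected Ω
  isBounded_Ω : Bornology.IsBounded Ω
  /-- a finite subgroup of `U(n)`, the group of linear isometries of `ℂⁿ` -/
  G : Subgroup (Cn n ≃ₗᵢ[ℂ] Cn n)
  finite_G : Finite G
  invariant_X : ∀ τ ∈ G, ∀ z ∈ X, τ z ∈ X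
  invariant_Γ : ∀ τ ∈ G, ∀ z ∈ Γ, τ z ∈ Γ
  Φ : Cn n → Cn n
  holomorphic_Φ : DifferentiableOn ℂ Φ X
  smooth_Φ : ∃ U : Set (Cn n), IsOpen U ∧ closure X ⊆ U ∧ ContDiffOn ℝ ∞ Φ U
  /-- `Φ` maps `X` onto `Ω` -/
  image_Φ : Φ '' X = Ω
  /-- `Φ : X → Ω` is proper -/
  proper_Φ : ∀ K ⊆ Ω, IsCompact K → IsCompact (X ∩ Φ ⁻¹' K)
  /-- the fibres of `Φ` on `X` are the orbits of `G`, so that `Φ` induces `X / G ≅ Ω` -/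
  fibre_X : ∀ z ∈ X, ∀ z' ∈ X, Φ z' = Φ z ↔ ∃ τ ∈ G, τ z = z'
  /-- almost every fibre of `Φ` on `Γ` is a single orbit of `G` -/
  fibre_Γ : ∀ᵐ z ∂(inducedMeasure d Γ), ∀ z' ∈ Γ, Φ z' = Φ z → ∃ τ ∈ G, τ z = z'

namespace QuotientQuadruple

variable {n : ℕ} (Q : QuotientQuadruple n)

/-- The induced boundary `Γ_Ω = Φ(Γ_X)`. -/
def ΓΩ : Set (Cn n) := Q.Φ '' Q.Γ

/-- The induced Lebesgue measure on `Γ_X`. -/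
noncomputable def σ : Measure (Cn n) := inducedMeasure Q.d Q.Γ

/-- The induced Lebesgue measure on `Γ_Ω`. -/
noncomputable def m : Measure (Cn n) := inducedMeasure Q.d Q.ΓΩ

/-- `w` is the (`G`-invariant) density with respect to `σ` of the pulled-back surface measure. -/
structure IsPullbackDensity (w : Cn n → ℝ) : Prop where
  measurable : Measurable w
  nonneg : ∀ z, 0 ≤ w z
  invariant : ∀ τ ∈ Q.G, ∀ᵐ z ∂Q.σ, w (τ z) = w z
  density : ∀ S : Set (Cn n), MeasurableSet S →
    (Nat.card Q.G : ℝ≥0∞)⁻¹ *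
      ∫⁻ z in Q.Γ ∩ Q.Φ ⁻¹' S, ENNReal.ofReal (w z) ∂(Measure.euclideanHausdorffMeasure Q.d)
        = Q.m S

/-- `g` witnesses that `w` is admissible: a `G`-invariant zero-free holomorphic function on `X` whose
boundary values `g*` exist and satisfy `|g*|² = w` almost everywhere on `Γ_X`. -/
structure IsAdmissible (w : Cn n → ℝ) (g : Cn n → ℂ) : Prop where
  holomorphic : DifferentiableOn ℂ g Q.X
  ne_zero : ∀ z ∈ Q.X, g z ≠ 0
  invariant : ∀ τ ∈ Q.G, ∀ z ∈ Q.X, g (τ z) = g z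
  boundary : ∀ᵐ z ∂Q.σ, ∃ l : ℂ, HasBoundaryValue g z l ∧ ‖l‖ ^ 2 = w z

/-- `F ∈ Hᵖ(X)`. -/
def MemHardyX (p : ℝ) (F : Cn n → ℂ) : Prop :=
  DifferentiableOn ℂ F Q.X ∧
    (⨆ r ∈ Ioo (0 : ℝ) 1, ∫⁻ z, ‖F ((r : ℂ) • z)‖ₑ ^ p ∂Q.σ) < ⊤

/-- `F ∈ Hᵖ(X, w^{1-p/2})`, where the weight `w^{1-p/2} = |g*|^{2-p}` on `Γ_X` is extended
to `X` as `|g|^{2-p}`. -/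
def MemWeightedHardyX (g : Cn n → ℂ) (p : ℝ) (F : Cn n → ℂ) : Prop :=
  DifferentiableOn ℂ F Q.X ∧
    (⨆ r ∈ Ioo (0 : ℝ) 1,
      ∫⁻ z, ‖F ((r : ℂ) • z)‖ₑ ^ p * ‖g ((r : ℂ) • z)‖ₑ ^ (2 - p) ∂Q.σ) < ⊤

/-- `f ∈ Hᵖ(Ω)`. -/
def MemHardyΩ (g : Cn n → ℂ) (p : ℝ) (f : Cn n → ℂ) : Prop :=
  DifferentiableOn ℂ f Q.Ω ∧
    (Nat.card Q.G : ℝ≥0∞)⁻¹ * (⨆ r ∈ Ioo (0 : ℝ) 1,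
      ∫⁻ z, ‖f (Q.Φ ((r : ℂ) • z))‖ₑ ^ p * ‖g ((r : ℂ) • z)‖ₑ ^ (2 : ℝ) ∂Q.σ) < ⊤

/-- `φ` is the boundary function `F*` of the function `F` on `X`. -/
def IsBoundaryX (F φ : Cn n → ℂ) : Prop := ∀ᵐ z ∂Q.σ, HasBoundaryValue F z (φ z)

/-- `φ` is (almost everywhere) the boundary function `f*` of the function `f` on `Ω`, which is given
on `Γ_Ω` by `f* (Φ z) = (f ∘ Φ)* (z)`. -/
def IsBoundaryΩ (f φ : Cn n → ℂ) : Prop :=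
  ∃ u : Cn n → ℂ, u =ᵐ[Q.m] φ ∧ ∀ᵐ z ∂Q.σ, HasBoundaryValue (f ∘ Q.Φ) z (u (Q.Φ z))

/-! Facts needed to see that the boundary functions of `H²` form a linear subspace of `L²`. -/

theorem smul_mem {z : Cn n} (hz : z ∈ Q.Γ) {r : ℝ} (hr : r ∈ Ioo (0 : ℝ) 1) :
    (r : ℂ) • z ∈ Q.X := by
  have hnorm : ∀ j, ‖((r : ℂ) • z) j‖ = r * ‖z j‖ := fun j => by
    simp [abs_of_pos hr.1]
  rcases Q.model with ⟨hX, hΓ, -⟩ | ⟨hX, -, -, hΓ, -⟩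
  · rw [hX]
    rw [hΓ] at hz
    intro j
    rw [hnorm, hz j, mul_one]
    exact hr.2
  · rw [hΓ] at hz
    have h1 : ∀ᶠ w in 𝓝 z, ∀ j, r * ‖z j‖ ≤ ‖w j‖ := by
      rw [Filter.eventually_all]
      intro j
      by_cases h0 : z j = 0
      · simp [h0]
      · have hlt : r * ‖z j‖ < ‖z j‖ := by
          have := norm_pos_iff.mpr h0
          nlinarith [hr.2]
        have hc : Continuous fun w : Cn n => ‖w j‖ := by fun_prop
        filter_upwards [hc.continuousAt.eventually_const_lt hlt] with w hw using hw.le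
    obtain ⟨w, hw, hwX⟩ :=
      ((mem_closure_iff_frequently.mp (frontier_subset_closure hz)).and_eventually h1).exists
    exact hX.2.2 w hw _ fun j => (hnorm j).le.trans (hwX j)

theorem measurableSet_Γ : MeasurableSet Q.Γ := by
  rcases Q.model with ⟨-, hΓ, -⟩ | ⟨-, -, -, hΓ, -⟩
  · have : Q.Γ = ⋂ j, {z : Cn n | ‖z j‖ = 1} := by
      rw [hΓ]
      ext z
      simp [unitTorus]
    rw [this]
    refine MeasurableSet.iInter fun j => ?_
    exact (isClosed_eq (by fun_prop) continuous_const).measurableSet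
  · rw [hΓ]
    exact isClosed_frontier.measurableSet

theorem aemeasurable_dilate {F : Cn n → ℂ} (hF : ContinuousOn F Q.X) {r : ℝ}
    (hr : r ∈ Ioo (0 : ℝ) 1) : AEMeasurable (fun z => F ((r : ℂ) • z)) Q.σ := by
  refine ContinuousOn.aemeasurable ?_ Q.measurableSet_Γ
  exact hF.comp (by fun_prop) fun z hz => Q.smul_mem hz hr

theorem continuousOn_comp_Φ {f : Cn n → ℂ} (hf : DifferentiableOn ℂ f Q.Ω) :
    ContinuousOn (fun z => f (Q.Φ z)) Q.X :=
  hf.continuousOn.comp Q.holomorphic_Φ.continuousOn fun z hz => by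
    rw [← Q.image_Φ]
    exact mem_image_of_mem _ hz

theorem iSup_lintegral_add_lt {ν : Measure (Cn n)} {u v : ℝ → Cn n → ℂ} {k : ℝ → Cn n → ℝ≥0∞}
    (hu : ∀ r ∈ Ioo (0 : ℝ) 1, AEMeasurable (u r) ν)
    (hk : ∀ r ∈ Ioo (0 : ℝ) 1, AEMeasurable (k r) ν)
    (h1 : (⨆ r ∈ Ioo (0 : ℝ) 1, ∫⁻ z, ‖u r z‖ₑ ^ (2 : ℝ) * k r z ∂ν) < ⊤)
    (h2 : (⨆ r ∈ Ioo (0 : ℝ) 1, ∫⁻ z, ‖v r z‖ₑ ^ (2 : ℝ) * k r z ∂ν) < ⊤) :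
    (⨆ r ∈ Ioo (0 : ℝ) 1, ∫⁻ z, ‖u r z + v r z‖ₑ ^ (2 : ℝ) * k r z ∂ν) < ⊤ := by
  set A := ⨆ r ∈ Ioo (0 : ℝ) 1, ∫⁻ z, ‖u r z‖ₑ ^ (2 : ℝ) * k r z ∂ν with hA
  set B := ⨆ r ∈ Ioo (0 : ℝ) 1, ∫⁻ z, ‖v r z‖ₑ ^ (2 : ℝ) * k r z ∂ν with hB
  have hbound : (⨆ r ∈ Ioo (0 : ℝ) 1, ∫⁻ z, ‖u r z + v r z‖ₑ ^ (2 : ℝ) * k r z ∂ν)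
      ≤ 2 * (A + B) := by
    refine iSup₂_le fun r hr => ?_
    calc ∫⁻ z, ‖u r z + v r z‖ₑ ^ (2 : ℝ) * k r z ∂ν
        ≤ ∫⁻ z, 2 * (‖u r z‖ₑ ^ (2 : ℝ) * k r z + ‖v r z‖ₑ ^ (2 : ℝ) * k r z) ∂ν := by
          refine lintegral_mono fun z => ?_
          have h := ENNReal.rpow_add_le_mul_rpow_add_rpow (‖u r z‖ₑ) (‖v r z‖ₑ)
            (p := 2) (by norm_num)
          have h' : ‖u r z + v r z‖ₑ ^ (2 : ℝ)
              ≤ 2 * (‖u r z‖ₑ ^ (2 : ℝ) + ‖v r z‖ₑ ^ (2 : ℝ)) := by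
            refine (ENNReal.rpow_le_rpow (enorm_add_le _ _) (by norm_num)).trans (h.trans_eq ?_)
            norm_num
          calc ‖u r z + v r z‖ₑ ^ (2 : ℝ) * k r z
              ≤ 2 * (‖u r z‖ₑ ^ (2 : ℝ) + ‖v r z‖ₑ ^ (2 : ℝ)) * k r z := by gcongr
            _ = _ := by rw [mul_assoc, add_mul]
      _ = 2 * (∫⁻ z, ‖u r z‖ₑ ^ (2 : ℝ) * k r z ∂ν + ∫⁻ z, ‖v r z‖ₑ ^ (2 : ℝ) * k r z ∂ν) := by
          rw [lintegral_const_mul' _ _ (by norm_num), lintegral_add_left']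
          exact ((hu r hr).enorm.pow_const _).mul (hk r hr)
      _ ≤ 2 * (A + B) := by
          gcongr
          · exact le_iSup₂ (f := fun r (_ : r ∈ Ioo (0 : ℝ) 1) =>
              ∫⁻ z, ‖u r z‖ₑ ^ (2 : ℝ) * k r z ∂ν) r hr
          · exact le_iSup₂ (f := fun r (_ : r ∈ Ioo (0 : ℝ) 1) =>
              ∫⁻ z, ‖v r z‖ₑ ^ (2 : ℝ) * k r z ∂ν) r hr
  exact hbound.trans_lt (ENNReal.mul_lt_top (by norm_num) (ENNReal.add_lt_top.mpr ⟨h1, h2⟩))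

theorem iSup_lintegral_smul_lt {ν : Measure (Cn n)} (c : ℂ) {u : ℝ → Cn n → ℂ}
    {k : ℝ → Cn n → ℝ≥0∞}
    (h1 : (⨆ r ∈ Ioo (0 : ℝ) 1, ∫⁻ z, ‖u r z‖ₑ ^ (2 : ℝ) * k r z ∂ν) < ⊤) :
    (⨆ r ∈ Ioo (0 : ℝ) 1, ∫⁻ z, ‖c * u r z‖ₑ ^ (2 : ℝ) * k r z ∂ν) < ⊤ := by
  have hc : ‖c‖ₑ ^ (2 : ℝ) ≠ ⊤ := ENNReal.rpow_ne_top_of_nonneg (by norm_num) enorm_ne_top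
  have : ∀ r, ∫⁻ z, ‖c * u r z‖ₑ ^ (2 : ℝ) * k r z ∂ν
      = ‖c‖ₑ ^ (2 : ℝ) * ∫⁻ z, ‖u r z‖ₑ ^ (2 : ℝ) * k r z ∂ν := fun r => by
    rw [← lintegral_const_mul' _ _ hc]
    refine lintegral_congr fun z => ?_
    rw [enorm_mul, ENNReal.mul_rpow_of_nonneg _ _ (by norm_num), mul_assoc]
  simp_rw [this, ← ENNReal.mul_iSup]
  exact ENNReal.mul_lt_top hc.lt_top h1

theorem MemHardyX.add {F F' : Cn n → ℂ} (h : Q.MemHardyX 2 F) (h' : Q.MemHardyX 2 F') :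
    Q.MemHardyX 2 (fun z => F z + F' z) := by
  refine ⟨h.1.add h'.1, ?_⟩
  have := iSup_lintegral_add_lt (ν := Q.σ) (u := fun r z => F ((r : ℂ) • z))
    (v := fun r z => F' ((r : ℂ) • z)) (k := fun _ _ => 1)
    (fun r hr => Q.aemeasurable_dilate h.1.continuousOn hr) (fun _ _ => aemeasurable_const)
    (by simpa using h.2) (by simpa using h'.2)
  simpa using this

theorem MemHardyX.const_mul {F : Cn n → ℂ} (c : ℂ) (h : Q.MemHardyX 2 F) :
    Q.MemHardyX 2 (fun z => c * F z) := by
  refine ⟨h.1.const_mul c, ?_⟩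
  have := iSup_lintegral_smul_lt (ν := Q.σ) c (u := fun r z => F ((r : ℂ) • z))
    (k := fun _ _ => 1) (by simpa using h.2)
  simpa using this

theorem card_inv_ne_zero : (Nat.card Q.G : ℝ≥0∞)⁻¹ ≠ 0 :=
  ENNReal.inv_ne_zero.mpr (ENNReal.natCast_ne_top _)

theorem card_inv_ne_top : (Nat.card Q.G : ℝ≥0∞)⁻¹ ≠ ⊤ := by
  have := Q.finite_G
  exact ENNReal.inv_ne_top.mpr (Nat.cast_ne_zero.mpr Nat.card_pos.ne')

theorem MemHardyΩ.add {g f f' : Cn n → ℂ} (hg : ContinuousOn g Q.X) (h : Q.MemHardyΩ g 2 f)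
    (h' : Q.MemHardyΩ g 2 f') : Q.MemHardyΩ g 2 (fun z => f z + f' z) := by
  refine ⟨h.1.add h'.1, ENNReal.mul_lt_top Q.card_inv_ne_top.lt_top ?_⟩
  exact iSup_lintegral_add_lt (ν := Q.σ) (u := fun r z => f (Q.Φ ((r : ℂ) • z)))
    (v := fun r z => f' (Q.Φ ((r : ℂ) • z)))
    (k := fun r z => ‖g ((r : ℂ) • z)‖ₑ ^ (2 : ℝ))
    (fun r hr => Q.aemeasurable_dilate (Q.continuousOn_comp_Φ h.1) hr)
    (fun r hr => (Q.aemeasurable_dilate hg hr).enorm.pow_const _)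
    (ENNReal.lt_top_of_mul_ne_top_right h.2.ne Q.card_inv_ne_zero)
    (ENNReal.lt_top_of_mul_ne_top_right h'.2.ne Q.card_inv_ne_zero)

theorem MemHardyΩ.const_mul {g f : Cn n → ℂ} (c : ℂ) (h : Q.MemHardyΩ g 2 f) :
    Q.MemHardyΩ g 2 (fun z => c * f z) := by
  refine ⟨h.1.const_mul c, ENNReal.mul_lt_top Q.card_inv_ne_top.lt_top ?_⟩
  exact iSup_lintegral_smul_lt (ν := Q.σ) c (u := fun r z => f (Q.Φ ((r : ℂ) • z)))
    (k := fun r z => ‖g ((r : ℂ) • z)‖ₑ ^ (2 : ℝ))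
    (ENNReal.lt_top_of_mul_ne_top_right h.2.ne Q.card_inv_ne_zero)

/-- `H²(X)` as a subspace of `L²(Γ_X)`, through boundary functions. -/
noncomputable def hardySubspaceX : Submodule ℂ (Lp ℂ 2 Q.σ) where
  carrier := {φ | ∃ F : Cn n → ℂ, Q.MemHardyX 2 F ∧ Q.IsBoundaryX F φ}
  zero_mem' := by
    refine ⟨fun _ => 0, ⟨differentiableOn_const 0, by simp⟩, ?_⟩
    filter_upwards [Lp.coeFn_zero ℂ 2 Q.σ] with z hz
    rw [hz]
    exact tendsto_const_nhds
  add_mem' := by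
    rintro φ ψ ⟨F, hF, hφ⟩ ⟨F', hF', hψ⟩
    refine ⟨fun z => F z + F' z, MemHardyX.add Q hF hF', ?_⟩
    filter_upwards [hφ, hψ, Lp.coeFn_add φ ψ] with z h1 h2 h3
    rw [h3]
    exact Tendsto.add h1 h2
  smul_mem' := by
    rintro c φ ⟨F, hF, hφ⟩
    refine ⟨fun z => c * F z, MemHardyX.const_mul Q c hF, ?_⟩
    filter_upwards [hφ, Lp.coeFn_smul c φ] with z h1 h3
    rw [h3]
    exact Tendsto.const_mul c h1

/-- `H²(Ω)` as a subspace of `L²(Γ_Ω)`, through boundary functions. -/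
noncomputable def hardySubspaceΩ (g : Cn n → ℂ) (hg : ContinuousOn g Q.X) :
    Submodule ℂ (Lp ℂ 2 Q.m) where
  carrier := {φ | ∃ f : Cn n → ℂ, Q.MemHardyΩ g 2 f ∧ Q.IsBoundaryΩ f φ}
  zero_mem' := by
    refine ⟨fun _ => 0, ⟨differentiableOn_const 0, by simp⟩, fun _ => 0, ?_, ?_⟩
    · exact (Lp.coeFn_zero ℂ 2 Q.m).symm
    · exact Eventually.of_forall fun z => tendsto_const_nhds
  add_mem' := by
    rintro φ ψ ⟨f, hf, u, hu, hφ⟩ ⟨f', hf', v, hv, hψ⟩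
    refine ⟨fun z => f z + f' z, MemHardyΩ.add Q hg hf hf', fun z => u z + v z, ?_, ?_⟩
    · filter_upwards [hu, hv, Lp.coeFn_add φ ψ] with z h1 h2 h3
      rw [h1, h2, h3, Pi.add_apply]
    · filter_upwards [hφ, hψ] with z h1 h2
      exact Tendsto.add h1 h2
  smul_mem' := by
    rintro c φ ⟨f, hf, u, hu, hφ⟩
    refine ⟨fun z => c * f z, MemHardyΩ.const_mul Q c hf, fun z => c * u z, ?_, ?_⟩
    · filter_upwards [hu, Lp.coeFn_smul c φ] with z h1 h3
      rw [h1, h3, Pi.smul_apply, smul_eq_mul]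
    · filter_upwards [hφ] with z h1
      exact Tendsto.const_mul c h1

/-- The Szegő projection `S_X`: the orthogonal projection of `L²(Γ_X)` onto `H²(X)`. (`H²(X)` is
closed in `L²(Γ_X)`, so taking the closure changes nothing; it makes the projection available
before closedness is proved.) -/
noncomputable def szegoX : Lp ℂ 2 Q.σ →L[ℂ] Lp ℂ 2 Q.σ :=
  Q.hardySubspaceX.topologicalClosure.starProjection

/-- The Szegő projection `S_Ω`: the orthogonal projection of `L²(Γ_Ω)` onto `H²(Ω)`
(again a closed subspace). -/
noncomputable def szegoΩ (g : Cn n → ℂ) (hg : ContinuousOn g Q.X) :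
    Lp ℂ 2 Q.m →L[ℂ] Lp ℂ 2 Q.m :=
  (Q.hardySubspaceΩ g hg).topologicalClosure.starProjection

/-- The measure `w^{1-p/2} dσ` on `Γ_X`. -/
noncomputable def weightedMeasure (w : Cn n → ℝ) (p : ℝ) : Measure (Cn n) :=
  Q.σ.withDensity fun z => ENNReal.ofReal (w z) ^ (1 - p / 2)

/-- `h` is a `G`-invariant function on `Γ_X` (almost everywhere). -/
def IsInvariantΓ (h : Cn n → ℂ) : Prop := ∀ τ ∈ Q.G, ∀ᵐ z ∂Q.σ, h (τ z) = h z

/-- `S_Ω` is bounded in the norm of `Lᵖ(Γ_Ω)`, which is also the norm `‖f‖ = ‖f*‖` of `Hᵖ(Ω)`. As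
usual this is an estimate on the dense subspace `L² ∩ Lᵖ`, on which `S_Ω` is defined. -/
def SzegoΩBounded (g : Cn n → ℂ) (hg : ContinuousOn g Q.X) (p : ℝ) : Prop :=
  ∃ C : ℝ≥0, ∀ φ : Lp ℂ 2 Q.m, MemLp φ (ENNReal.ofReal p) Q.m →
    eLpNorm (Q.szegoΩ g hg φ) (ENNReal.ofReal p) Q.m ≤ C * eLpNorm φ (ENNReal.ofReal p) Q.m

/-- `S_X` is bounded on the `G`-invariant functions in `Lᵖ(Γ_X, w^{1-p/2})`. -/
def SzegoXBoundedOnInvariant (w : Cn n → ℝ) (p : ℝ) : Prop :=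
  ∃ C : ℝ≥0, ∀ h : Lp ℂ 2 Q.σ, Q.IsInvariantΓ h →
    MemLp h (ENNReal.ofReal p) (Q.weightedMeasure w p) →
    eLpNorm (Q.szegoX h) (ENNReal.ofReal p) (Q.weightedMeasure w p)
      ≤ C * eLpNorm h (ENNReal.ofReal p) (Q.weightedMeasure w p)

/-- `S_Ω` maps (the dense subspace `L² ∩ Lᵖ` of) `Lᵖ(Γ_Ω)` into `Hᵖ(Ω)`: the function in `H²(Ω)`
whose boundary function is `S_Ω φ` belongs to `Hᵖ(Ω)`. -/
def SzegoΩMapsToHardy (g : Cn n → ℂ) (hg : ContinuousOn g Q.X) (p : ℝ) : Prop :=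
  ∀ φ : Lp ℂ 2 Q.m, MemLp φ (ENNReal.ofReal p) Q.m →
    ∃ f : Cn n → ℂ, Q.MemHardyΩ g 2 f ∧ Q.MemHardyΩ g p f ∧ Q.IsBoundaryΩ f (Q.szegoΩ g hg φ)

/-- `S_X` maps the `G`-invariant functions in `Lᵖ(Γ_X, w^{1-p/2})` into `Hᵖ(X, w^{1-p/2})`. -/
def SzegoXMapsInvariantToHardy (w : Cn n → ℝ) (g : Cn n → ℂ) (p : ℝ) : Prop :=
  ∀ h : Lp ℂ 2 Q.σ, Q.IsInvariantΓ h →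
    MemLp h (ENNReal.ofReal p) (Q.weightedMeasure w p) →
    ∃ F : Cn n → ℂ, Q.MemHardyX 2 F ∧ Q.MemWeightedHardyX g p F ∧ Q.IsBoundaryX F (Q.szegoX h)

end QuotientQuadruple

/-!
Let `g*` be the boundary function of `g`. The map `φ ↦ |G|^{-1/2} (φ ∘ Φ) g*` is an isometry of
`L²(Γ_Ω)` onto the `G`-invariant part of `L²(Γ_X)`, and because `|g*|^p w^{1-p/2} = w` it multiplies
the norm of `Lᵖ(Γ_Ω)`, taken to that of `Lᵖ(Γ_X, w^{1-p/2})`, by a constant; likewise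
`f ↦ |G|^{-1/2} (f ∘ Φ) g` identifies the Hardy spaces of `Ω` with the invariant parts of those
of `X`. Averaging over `G` preserves the Hardy spaces of `X`, and an invariant holomorphic function
on `X` descends to a holomorphic function on `Ω`: off the critical values `Φ` is locally
biholomorphic, and the critical values lie in the zeros of a holomorphic function. Hence the map
intertwines `S_Ω` and `S_X`, and both equivalences follow.

All this needs `w > 0` almost everywhere. The Jacobian determinant of `Φ` is holomorphic and not
identically zero, so for almost every `z ∈ Γ_X` it is nonzero at almost every point of the torus
through `z`; where it is nonzero, `Φ` is locally bi-Lipschitz, so a set of positive measure is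
mapped to a set of positive measure, on which the density cannot vanish.
-/

section SeveralVariables

open Metric

variable {E F : Type*} [NormedAddCommGroup E] [NormedSpace ℂ E]
  [NormedAddCommGroup F] [NormedSpace ℂ F]

theorem norm_fderiv_le_of_norm_le_on_ball {f : E → F} {c : E} {r M : ℝ} (hr : 0 < r)
    (hf : DifferentiableOn ℂ f (ball c r)) (hM : ∀ z ∈ ball c r, ‖f z‖ ≤ M) :
    ‖fderiv ℂ f c‖ ≤ 2 * M / r := by
  refine Complex.norm_fderiv_le_div_of_mapsTo_ball hf (fun z hz => ?_) hr
  rw [mem_closedBall, dist_eq_norm]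
  linarith [norm_sub_le (f z) (f c), hM z hz, hM c (mem_ball_self hr)]

section ParametricIntegral

variable [ProperSpace E] {z₀ : E} {r : ℝ}

theorem continuousOn_fderiv_of_continuousOn_prod {T : Type*} [PseudoMetricSpace T] {S : Set T}
    {K : E → T → F} (hr : 0 < r) (hS : IsCompact S)
    (hK : ContinuousOn (Function.uncurry K) (closedBall z₀ r ×ˢ S))
    (hd : ∀ t ∈ S, DifferentiableOn ℂ (fun z => K z t) (ball z₀ r)) :
    ContinuousOn (fun t => fderiv ℂ (fun z => K z t) z₀) S := by
  have hunif := ((isCompact_closedBall z₀ r).prod hS).uniformContinuousOn_of_continuous hK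
  have hdz : ∀ t ∈ S, DifferentiableAt ℂ (fun z => K z t) z₀ := fun t ht =>
    (hd t ht).differentiableAt (ball_mem_nhds z₀ hr)
  refine Metric.continuousOn_iff.mpr fun t₀ ht₀ ε hε => ?_
  obtain ⟨δ, hδ, hclose⟩ := Metric.uniformContinuousOn_iff.mp hunif (ε * r / 4) (by positivity)
  refine ⟨δ, hδ, fun t ht htδ => ?_⟩
  have hbound : ‖fderiv ℂ (fun z => K z t - K z t₀) z₀‖ ≤ 2 * (ε * r / 4) / r := by
    refine norm_fderiv_le_of_norm_le_on_ball hr ((hd t ht).fun_sub (hd t₀ ht₀)) fun z hz => ?_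
    have hz' := ball_subset_closedBall hz
    rw [← dist_eq_norm]
    exact (hclose (z, t) ⟨hz', ht⟩ (z, t₀) ⟨hz', ht₀⟩ (by simp [Prod.dist_eq, htδ])).le
  rw [dist_eq_norm, ← fderiv_fun_sub (hdz t ht) (hdz t₀ ht₀)]
  calc _ ≤ 2 * (ε * r / 4) / r := hbound
    _ = ε / 2 := by field_simp; norm_num
    _ < ε := half_lt_self hε

theorem differentiableAt_intervalIntegral_of_continuousOn {K : E → ℝ → F} {a b : ℝ} (hr : 0 < r)
    (hK : ContinuousOn (Function.uncurry K) (closedBall z₀ r ×ˢ uIcc a b))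
    (hd : ∀ θ ∈ uIcc a b, DifferentiableOn ℂ (fun z => K z θ) (ball z₀ r)) :
    DifferentiableAt ℂ (fun z => ∫ θ in a..b, K z θ) z₀ := by
  obtain ⟨M, hM⟩ :=
    ((isCompact_closedBall z₀ r).prod isCompact_uIcc).exists_bound_of_continuousOn hK
  have hKz : ∀ z ∈ closedBall z₀ r, ContinuousOn (K z) (uIcc a b) := fun z hz =>
    hK.comp (f := fun θ => (z, θ)) (by fun_prop) fun θ hθ => ⟨hz, hθ⟩
  have hfderiv := continuousOn_fderiv_of_continuousOn_prod hr isCompact_uIcc hK hd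
  have hsub : ∀ x ∈ ball z₀ (r / 2), ball x (r / 2) ⊆ ball z₀ r := fun x hx =>
    ball_subset_ball' (by rw [mem_ball] at hx; linarith)
  refine (intervalIntegral.hasFDerivAt_integral_of_dominated_of_fderiv_le
    (𝕜 := ℂ) (F' := fun z θ => fderiv ℂ (fun z => K z θ) z) (s := ball z₀ (r / 2))
    (bound := fun _ => 2 * M / (r / 2)) (ball_mem_nhds _ (by positivity)) ?_ ?_ ?_ ?_
    (by simp) ?_).differentiableAt
  · filter_upwards [ball_mem_nhds z₀ hr] with z hz
    exact ((hKz z (ball_subset_closedBall hz)).mono uIoc_subset_uIcc).aestronglyMeasurable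
      measurableSet_uIoc
  · exact (hKz z₀ (mem_closedBall_self hr.le)).intervalIntegrable
  · exact (hfderiv.mono uIoc_subset_uIcc).aestronglyMeasurable measurableSet_uIoc
  · refine Eventually.of_forall fun θ hθ x hx => norm_fderiv_le_of_norm_le_on_ball (by positivity)
      ((hd θ (uIoc_subset_uIcc hθ)).mono (hsub x hx)) fun z hz => ?_
    exact hM (z, θ) ⟨ball_subset_closedBall (hsub x hx hz), uIoc_subset_uIcc hθ⟩
  · refine Eventually.of_forall fun θ hθ x hx => DifferentiableAt.hasFDerivAt ?_
    exact (hd θ (uIoc_subset_uIcc hθ)).differentiableAt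
      (isOpen_ball.mem_nhds (ball_subset_ball (by linarith) hx))

theorem differentiableAt_circleIntegral_of_continuousOn {K : E → ℂ → F} {c : ℂ} {ρ : ℝ}
    (hr : 0 < r) (hρ : 0 ≤ ρ)
    (hK : ContinuousOn (Function.uncurry K) (closedBall z₀ r ×ˢ sphere c ρ))
    (hd : ∀ ζ ∈ sphere c ρ, DifferentiableOn ℂ (fun z => K z ζ) (ball z₀ r)) :
    DifferentiableAt ℂ (fun z => ∮ ζ in C(c, ρ), K z ζ) z₀ := by
  have hmem : ∀ θ, circleMap c ρ θ ∈ sphere c ρ := circleMap_mem_sphere c hρ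
  simp only [circleIntegral, deriv_circleMap]
  refine differentiableAt_intervalIntegral_of_continuousOn hr ?_ fun θ _ =>
    (hd _ (hmem θ)).const_smul _
  refine ContinuousOn.smul (by fun_prop) ?_
  exact hK.comp (f := fun x : E × ℝ => (x.1, circleMap c ρ x.2)) (by fun_prop)
    fun x hx => ⟨hx.1, hmem x.2⟩

theorem differentiableAt_circleIntegral_line {φ : ℂ → ℂ} {f : E → F} {v : E} {ρ : ℝ}
    (hρ : 0 ≤ ρ) (hφ : ContinuousOn φ (sphere 0 ρ))
    (hf : ∀ᶠ z in 𝓝 z₀, ∀ ζ ∈ sphere (0 : ℂ) ρ, DifferentiableAt ℂ f (z + ζ • v)) :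
    DifferentiableAt ℂ (fun z => ∮ ζ in C(0, ρ), φ ζ • f (z + ζ • v)) z₀ := by
  obtain ⟨r, hr, hf⟩ := Metric.nhds_basis_closedBall.eventually_iff.mp hf
  refine differentiableAt_circleIntegral_of_continuousOn hr hρ ?_ fun ζ hζ z hz => ?_
  · refine (hφ.comp continuousOn_snd fun x hx => hx.2).smul fun x hx => ?_
    exact ((hf hx.1 x.2 hx.2).continuousAt.comp (f := fun x : E × ℂ => x.1 + x.2 • v)
      (by fun_prop)).continuousWithinAt
  · exact (DifferentiableAt.const_smul (DifferentiableAt.comp (f := fun z => z + ζ • v) z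
      (hf (ball_subset_closedBall hz) ζ hζ) (by fun_prop)) _).differentiableWithinAt

end ParametricIntegral

theorem eventually_forall_add_smul_mem {V : Set E} (hV : IsOpen V) {K : Set ℂ} (hK : IsCompact K)
    {a v : E} (h : ∀ ζ ∈ K, a + ζ • v ∈ V) : ∀ᶠ z in 𝓝 a, ∀ ζ ∈ K, z + ζ • v ∈ V :=
  hK.eventually_forall_of_forall_eventually fun ζ hζ =>
    (Continuous.continuousAt (f := fun x : E × ℂ => x.1 + x.2 • v) (by fun_prop)).preimage_mem_nhds
      (hV.mem_nhds (h ζ hζ))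

theorem differentiableOn_fderiv_apply [ProperSpace E] [CompleteSpace F] {f : E → F} {U : Set E}
    (hU : IsOpen U) (hf : DifferentiableOn ℂ f U) (v : E) :
    DifferentiableOn ℂ (fun z => fderiv ℂ f z v) U := by
  intro a ha
  have hline : ∀ z, IsOpen {ζ : ℂ | z + ζ • v ∈ U} := fun z => hU.preimage (by fun_prop)
  obtain ⟨ρ, hρ, hmem⟩ := Metric.nhds_basis_closedBall.mem_iff.mp
    ((hline a).mem_nhds (show (0 : ℂ) ∈ _ by simpa using ha))
  have htube := eventually_forall_add_smul_mem hU (isCompact_closedBall (0 : ℂ) ρ) hmem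
  have hcauchy : ∀ᶠ z in 𝓝 a, fderiv ℂ f z v =
      (2 * Real.pi * Complex.I : ℂ)⁻¹ • ∮ ζ in C(0, ρ), (ζ ^ 2)⁻¹ • f (z + ζ • v) := by
    filter_upwards [htube] with z hz
    have hfz : DifferentiableAt ℂ f z :=
      hf.differentiableAt (hU.mem_nhds (by simpa using hz 0 (mem_closedBall_self hρ.le)))
    have hpow := Complex.two_pi_I_inv_smul_circleIntegral_sub_sq_inv_smul_of_differentiable
      (hline z) hz (hf.comp (by fun_prop) fun ζ hζ => hζ) (mem_ball_self hρ)
    rw [← hfz.lineDeriv_eq_fderiv]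
    simpa only [sub_zero] using! hpow.symm
  refine (DifferentiableAt.congr_of_eventuallyEq (DifferentiableAt.const_smul ?_ _)
    hcauchy).differentiableWithinAt
  refine differentiableAt_circleIntegral_line hρ.le ?_ (htube.mono fun z hz ζ hζ =>
    hf.differentiableAt (hU.mem_nhds (hz ζ (sphere_subset_closedBall hζ))))
  exact (continuousOn_pow 2).inv₀ fun ζ hζ => pow_ne_zero 2 (ne_of_mem_sphere hζ hρ.ne')

section OffZeros

theorem exists_sphere_forall_ne_zero {u : ℂ → F} {U : Set ℂ} (hu : AnalyticOnNhd ℂ u U)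
    (hU : IsOpen U) (hpre : IsPreconnected U) {b c : ℂ} (hb : b ∈ U) (hub : u b ≠ 0) (hc : c ∈ U) :
    ∃ ρ > 0, closedBall c ρ ⊆ U ∧ ∀ ζ ∈ sphere c ρ, u ζ ≠ 0 := by
  have hne : ∀ᶠ ζ in 𝓝[≠] c, u ζ ≠ 0 :=
    (hu c hc).eventually_eq_zero_or_eventually_ne_zero.resolve_left fun h =>
      hub (hu.eqOn_zero_of_preconnected_of_eventuallyEq_zero hpre hc h hb)
  obtain ⟨ρ, hρ, h⟩ := Metric.nhds_basis_closedBall.eventually_iff.mp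
    ((hU.eventually_mem hc).and (eventually_nhdsWithin_iff.mp hne))
  exact ⟨ρ, hρ, fun ζ hζ => (h hζ).1, fun ζ hζ =>
    (h (sphere_subset_closedBall hζ)).2 (ne_of_mem_sphere hζ hρ.ne')⟩

theorem isPreconnected_line_ball (a z v : E) (r : ℝ) :
    IsPreconnected {ζ : ℂ | z + ζ • v ∈ ball a r} :=
  (((convex_ball a r).translate_preimage_right z).is_linear_preimage
    (f := fun ζ : ℂ => ζ • v)
    ⟨fun _ _ => add_smul _ _ _, fun _ _ => smul_assoc _ _ _⟩).isPreconnected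

variable {f : E → F} {e : E → ℂ} {a : E} {r : ℝ}

theorem analyticOnNhd_line (he : DifferentiableOn ℂ e (ball a r)) (z v : E) :
    AnalyticOnNhd ℂ (fun ζ : ℂ => e (z + ζ • v)) {ζ | z + ζ • v ∈ ball a r} :=
  DifferentiableOn.analyticOnNhd (he.comp (by fun_prop) fun ζ hζ => hζ)
    (isOpen_ball.preimage (by fun_prop))

theorem two_pi_I_inv_smul_circleIntegral_line [CompleteSpace F]
    (hf : ContinuousOn f (ball a r)) (he : DifferentiableOn ℂ e (ball a r))
    (hfe : ∀ z ∈ ball a r, e z ≠ 0 → DifferentiableAt ℂ f z) {z v : E} {ρ : ℝ} (hρ : 0 < ρ)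
    (hz : ∀ ζ ∈ closedBall (0 : ℂ) ρ, z + ζ • v ∈ ball a r)
    (hne : ∃ ζ ∈ closedBall (0 : ℂ) ρ, e (z + ζ • v) ≠ 0) :
    ((2 * Real.pi * Complex.I : ℂ)⁻¹ • ∮ ζ in C(0, ρ), ζ⁻¹ • f (z + ζ • v)) = f z := by
  obtain ⟨ζ₀, hζ₀, hne⟩ := hne
  have hconn : IsConnected {ζ : ℂ | z + ζ • v ∈ ball a r} :=
    ⟨⟨ζ₀, hz ζ₀ hζ₀⟩, isPreconnected_line_ball a z v r⟩
  have hzeros := (isCompact_closedBall (0 : ℂ) ρ).finite_sdiff_of_mem_codiscreteWithin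
    (codiscreteWithin_mono hz
      ((analyticOnNhd_line he z v).preimage_zero_mem_codiscreteWithin hne (hz ζ₀ hζ₀) hconn))
  have hcauchy :=
    Complex.two_pi_I_inv_smul_circleIntegral_sub_inv_smul_of_differentiable_on_off_countable
      hzeros.countable (mem_ball_self hρ)
      (hf.comp (f := fun ζ : ℂ => z + ζ • v) (by fun_prop) hz) fun ζ hζ => by
        have hζρ := ball_subset_closedBall hζ.1
        exact DifferentiableAt.comp (f := fun ζ : ℂ => z + ζ • v) ζ
          (hfe _ (hz ζ hζρ) fun h => hζ.2 ⟨hζρ, not_not.mpr h⟩) (by fun_prop)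
  simpa only [sub_zero, Function.comp_apply, zero_smul, add_zero] using hcauchy

theorem differentiableOn_of_continuousOn_of_differentiableAt_off_zeros [ProperSpace E]
    [CompleteSpace F] {U : Set E} (hU : IsOpen U) (hf : ContinuousOn f U)
    (he : DifferentiableOn ℂ e U) (hfe : ∀ z ∈ U, e z ≠ 0 → DifferentiableAt ℂ f z)
    (hdense : ∀ V ⊆ U, IsOpen V → V.Nonempty → ∃ z ∈ V, e z ≠ 0) :
    DifferentiableOn ℂ f U := by
  intro a ha
  obtain ⟨r, hr, hball⟩ := Metric.isOpen_iff.mp hU a ha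
  obtain ⟨b, hb, hbe⟩ := hdense (ball a r) hball isOpen_ball ⟨a, mem_ball_self hr⟩
  have heB := he.mono hball
  obtain ⟨ρ, hρ, hmem, hne⟩ := exists_sphere_forall_ne_zero (analyticOnNhd_line heB a (b - a))
    (isOpen_ball.preimage (by fun_prop)) (isPreconnected_line_ball a a (b - a) r)
    (b := 1) (c := 0) (by simpa [dist_eq_norm] using hb) (by simpa using hbe) (by simpa using hr)
  have htube := eventually_forall_add_smul_mem isOpen_ball (isCompact_closedBall (0 : ℂ) ρ) hmem
  have htube_ne := eventually_forall_add_smul_mem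
    (heB.continuousOn.isOpen_inter_preimage isOpen_ball isOpen_compl_singleton)
    (isCompact_sphere (0 : ℂ) ρ) fun ζ hζ => ⟨hmem (sphere_subset_closedBall hζ), hne ζ hζ⟩
  have hcauchy : f =ᶠ[𝓝 a] fun z =>
      (2 * Real.pi * Complex.I : ℂ)⁻¹ • ∮ ζ in C(0, ρ), ζ⁻¹ • f (z + ζ • (b - a)) := by
    filter_upwards [htube, htube_ne] with z hz hz_ne
    have hρmem : (ρ : ℂ) ∈ sphere (0 : ℂ) ρ := by simp [abs_of_pos hρ]
    exact (two_pi_I_inv_smul_circleIntegral_line (hf.mono hball) heB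
      (fun z hz => hfe z (hball hz)) hρ hz
      ⟨ρ, sphere_subset_closedBall hρmem, (hz_ne ρ hρmem).2⟩).symm
  refine (DifferentiableAt.congr_of_eventuallyEq (DifferentiableAt.const_smul ?_ _)
    hcauchy).differentiableWithinAt
  refine differentiableAt_circleIntegral_line hρ.le ?_ (htube_ne.mono fun z hz ζ hζ =>
    hfe _ (hball (hz ζ hζ).1) (hz ζ hζ).2)
  exact continuousOn_id.inv₀ fun ζ hζ => ne_of_mem_sphere hζ hρ.ne'

end OffZeros

end SeveralVariables

section CircleUniqueness

open Metric Real

theorem exists_le_circleAverage_log_norm {k : ℂ → ℂ} (hk : AnalyticOnNhd ℂ k (ball 0 1)) :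
    ∃ B : ℝ, ∀ r ∈ Ioo (1 / 2 : ℝ) 1, B ≤ circleAverage (fun z => log ‖k z‖) 0 r := by
  set d : ℝ := ((meromorphicOrderAt k 0).untop₀ : ℝ) with hd
  have hd0 : 0 ≤ d := by
    rw [hd]
    exact_mod_cast WithTop.untop₀_nonneg.mpr (hk 0 (by simp)).meromorphicOrderAt_nonneg
  -- Jensen's formula, in which the contribution of the zeros off the origin is nonnegative.
  refine ⟨d * log (1 / 2) + log ‖meromorphicTrailingCoeffAt k 0‖, fun r hr => ?_⟩
  have hr0 : 0 < r := by linarith [hr.1]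
  have hk' : AnalyticOnNhd ℂ k (closedBall 0 |r|) :=
    hk.mono (by rw [abs_of_pos hr0]; exact closedBall_subset_ball hr.2)
  have hzeros : 0 ≤ ∑ᶠ u, (MeromorphicOn.divisor k (closedBall 0 |r|) u : ℝ)
      * log (r * ‖0 - u‖⁻¹) := by
    refine finsum_nonneg fun u => ?_
    by_cases hu : u ∈ closedBall (0 : ℂ) |r|
    · refine mul_nonneg
        (mod_cast MeromorphicOn.AnalyticOnNhd.divisor_nonneg hk' u) ?_
      rcases eq_or_ne u 0 with rfl | hu0
      · simp
      · refine log_nonneg ?_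
        rw [zero_sub, norm_neg, ← div_eq_mul_inv, one_le_div (norm_pos_iff.mpr hu0)]
        simpa [abs_of_pos hr0] using hu
    · simp [hu]
  have horigin : d * log (1 / 2) ≤ d * log r :=
    mul_le_mul_of_nonneg_left (log_le_log (by norm_num) hr.1.le) hd0
  rw [hk'.meromorphicOn.circleAverage_log_norm hr0.ne',
    MeromorphicOn.divisor_apply hk'.meromorphicOn (by simp)]
  linarith

theorem circleAverage_log_norm_le_log_max {k : ℂ → ℂ} {c : ℂ} {r ε : ℝ} (hr : r ≠ 0) (hε : 0 < ε)
    (hk : AnalyticOnNhd ℂ k (sphere c |r|))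
    (hne : ∀ᶠ z in codiscreteWithin (sphere c |r|), k z ≠ 0) :
    circleAverage (fun z => log ‖k z‖) c r ≤
      circleAverage (fun z => log (max ‖k z‖ ε)) c r := by
  -- At the zeros of `k` the junk value `log 0 = 0` is replaced by `log ε`.
  have hcongr : (fun z => log ‖k z‖) =ᶠ[codiscreteWithin (sphere c |r|)]
      fun z => if k z = 0 then log ε else log ‖k z‖ := by
    filter_upwards [hne] with z hz
    rw [if_neg hz]
  have hmax : ContinuousOn (fun z => log (max ‖k z‖ ε)) (sphere c |r|) :=
    ContinuousOn.log (hk.continuousOn.norm.sup continuousOn_const)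
      fun z _ => (lt_max_of_lt_right hε).ne'
  rw [circleAverage_congr_codiscreteWithin hcongr hr]
  refine circleAverage_mono
    (hk.meromorphicOn.circleIntegrable_log_norm.congr_codiscreteWithin hcongr)
    hmax.circleIntegrable' fun z _ => ?_
  split_ifs with h
  · simp [h, max_eq_right hε.le]
  · exact log_le_log (norm_pos_iff.mpr h) (le_max_left _ _)

theorem le_circleAverage_of_forall_Ioo {u : ℂ → ℝ} {c : ℂ} {R₀ R B : ℝ} (h0 : 0 ≤ R₀) (hR : R₀ < R)
    (hu : ContinuousOn u (closedBall c R)) (hB : ∀ r ∈ Ioo R₀ R, B ≤ circleAverage u c r) :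
    B ≤ circleAverage u c R := by
  have hcont : ContinuousOn (circleAverage u c) (Icc R₀ R) :=
    ContinuousOn.circleAverage (hu.mono fun z hz => mem_closedBall_iff_norm.mpr hz.2)
      fun r hr => h0.trans hr.1
  have hlim : Tendsto (circleAverage u c) (𝓝[Ioo R₀ R] R) (𝓝 (circleAverage u c R)) :=
    (hcont R ⟨hR.le, le_rfl⟩).mono Ioo_subset_Icc_self
  rw [nhdsWithin_Ioo_eq_nhdsLT hR] at hlim
  exact ge_of_tendsto hlim (eventually_of_mem (Ioo_mem_nhdsLT hR) hB)

theorem circleAverage_log_max_le {k : ℂ → ℂ} {c : ℂ} {R M ε : ℝ}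
    (hk : ContinuousOn k (sphere c |R|)) (hM : ∀ z ∈ sphere c |R|, ‖k z‖ ≤ M) (hM1 : 1 ≤ M)
    (hε : 0 < ε) (hε1 : ε ≤ 1) :
    circleAverage (fun z => log (max ‖k z‖ ε)) c R ≤ log M + (2 * π)⁻¹ *
      ((volume.restrict (Ioc 0 (2 * π))).real {θ | k (circleMap c R θ) = 0} * log ε) := by
  have hmap : ∀ θ, circleMap c R θ ∈ sphere c |R| := circleMap_mem_sphere' c R
  have hkθ : Continuous fun θ => k (circleMap c R θ) :=
    hk.comp_continuous (continuous_circleMap c R) hmap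
  set Z := {θ | k (circleMap c R θ) = 0}
  have hZ : MeasurableSet Z := (isClosed_singleton.preimage hkθ).measurableSet
  have hbound : ∀ θ, log (max ‖k (circleMap c R θ)‖ ε) ≤
      log M + Z.indicator (fun _ => log ε) θ := fun θ => by
    by_cases hθ : θ ∈ Z
    · rw [indicator_of_mem hθ, show k (circleMap c R θ) = 0 from hθ, norm_zero,
        max_eq_right hε.le]
      exact le_add_of_nonneg_left (log_nonneg hM1)
    · rw [indicator_of_notMem hθ, add_zero]
      exact log_le_log (lt_max_of_lt_right hε) (max_le (hM _ (hmap θ)) (hε1.trans hM1))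
  have hint : IntegrableOn (Z.indicator fun _ => log ε) (Ioc 0 (2 * π)) :=
    (integrable_const _).indicator hZ
  calc circleAverage (fun z => log (max ‖k z‖ ε)) c R
      ≤ (2 * π)⁻¹ * ∫ θ in (0 : ℝ)..2 * π, (log M + Z.indicator (fun _ => log ε) θ) := by
        refine mul_le_mul_of_nonneg_left ?_ (by positivity)
        refine intervalIntegral.integral_mono_on two_pi_pos.le ?_ ?_ fun θ _ => hbound θ
        · exact (Continuous.log (hkθ.norm.sup continuous_const)
            fun θ => (lt_max_of_lt_right hε).ne').intervalIntegrable _ _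
        · rw [intervalIntegrable_iff_integrableOn_Ioc_of_le two_pi_pos.le]
          exact (integrable_const _).add hint
    _ = _ := by
        rw [intervalIntegral.integral_of_le two_pi_pos.le, integral_add (integrable_const _) hint,
          integral_indicator_const _ hZ, integral_const, smul_eq_mul, smul_eq_mul,
          measureReal_restrict_apply_univ, volume_real_Ioc_of_le two_pi_pos.le]
        field_simp
        ring

theorem eq_zero_of_volume_zeros_circle_ne_zero {k : ℂ → ℂ}
    (hc : ContinuousOn k (closedBall 0 1)) (hd : DifferentiableOn ℂ k (ball 0 1))
    (hpos : (volume.restrict (Ioc 0 (2 * π))) {θ : ℝ | k (circleMap 0 1 θ) = 0} ≠ 0) :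
    ∀ ζ ∈ closedBall (0 : ℂ) 1, k ζ = 0 := by
  have hanal : AnalyticOnNhd ℂ k (ball 0 1) := hd.analyticOnNhd isOpen_ball
  rcases hanal.eqOn_zero_or_eventually_ne_zero_of_preconnected
    (convex_ball (0 : ℂ) 1).isPreconnected with h | hne
  · exact EqOn.of_subset_closure h hc continuousOn_const ball_subset_closedBall
      (closure_ball (0 : ℂ) one_ne_zero).ge
  exfalso
  obtain ⟨B, hB⟩ := exists_le_circleAverage_log_norm hanal
  obtain ⟨M, hM⟩ := (isCompact_closedBall (0 : ℂ) 1).exists_bound_of_continuousOn hc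
  set c : ℝ := (volume.restrict (Ioc 0 (2 * π))).real {θ : ℝ | k (circleMap 0 1 θ) = 0}
  have hcpos : 0 < c := ENNReal.toReal_pos hpos (measure_ne_top _ _)
  have hlower : ∀ ε > 0, B ≤ circleAverage (fun z => log (max ‖k z‖ ε)) 0 1 := fun ε hε => by
    refine le_circleAverage_of_forall_Ioo (by norm_num) (by norm_num : (1 / 2 : ℝ) < 1)
      (ContinuousOn.log (hc.norm.sup continuousOn_const) fun z _ => (lt_max_of_lt_right hε).ne')
      fun r hr => (hB r hr).trans ?_
    have hr0 : 0 < r := by linarith [hr.1]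
    have hsub : sphere (0 : ℂ) |r| ⊆ ball 0 1 := by
      rw [abs_of_pos hr0]
      exact sphere_subset_closedBall.trans (closedBall_subset_ball hr.2)
    exact circleAverage_log_norm_le_log_max hr0.ne' hε (hanal.mono hsub)
      (codiscreteWithin_mono hsub hne)
  have hupper : ∀ T : ℝ, 0 ≤ T → B ≤ log (max M 1) - (2 * π)⁻¹ * (c * T) := fun T hT => by
    have hsub : sphere (0 : ℂ) |1| ⊆ closedBall 0 1 := by
      rw [abs_one]
      exact sphere_subset_closedBall
    have := (hlower _ (exp_pos (-T))).trans (circleAverage_log_max_le (hc.mono hsub)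
      (fun z hz => (hM z (hsub hz)).trans (le_max_left M 1)) (le_max_right M 1) (exp_pos (-T))
      (exp_le_one_iff.mpr (by linarith)))
    rw [log_exp] at this
    linarith
  have hT := hupper (2 * π * (|log (max M 1) - B| + 1) / c) (by positivity)
  rw [mul_div_cancel₀ _ hcpos.ne', inv_mul_cancel_left₀ two_pi_pos.ne'] at hT
  linarith [le_abs_self (log (max M 1) - B)]

end CircleUniqueness

section TorusUniqueness

open Metric Real

theorem cons_mem_closedBall_zero_one_iff {N : ℕ} {z : ℂ} {w : Fin N → ℂ} :
    Fin.cons z w ∈ closedBall (0 : Fin (N + 1) → ℂ) 1 ↔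
      z ∈ closedBall (0 : ℂ) 1 ∧ w ∈ closedBall (0 : Fin N → ℂ) 1 := by
  simp [pi_norm_le_iff_of_nonneg, Fin.forall_fin_succ]

theorem cons_mem_ball_zero_one_iff {N : ℕ} {z : ℂ} {w : Fin N → ℂ} :
    Fin.cons z w ∈ ball (0 : Fin (N + 1) → ℂ) 1 ↔
      z ∈ ball (0 : ℂ) 1 ∧ w ∈ ball (0 : Fin N → ℂ) 1 := by
  simp [pi_norm_lt_iff, Fin.forall_fin_succ]

theorem circleMap_zero_one_mem_closedBall {N : ℕ} (θ : Fin N → ℝ) :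
    (fun j => circleMap 0 1 (θ j)) ∈ closedBall (0 : Fin N → ℂ) 1 := by
  simp [pi_norm_le_iff_of_nonneg]

theorem differentiable_finCons_left {N : ℕ} (w : Fin N → ℂ) :
    Differentiable ℂ fun z : ℂ => (Fin.cons z w : Fin (N + 1) → ℂ) :=
  differentiable_pi.mpr <| Fin.cases (by simp) fun i => by simp

theorem differentiable_finCons_right {N : ℕ} (z : ℂ) :
    Differentiable ℂ fun w : Fin N → ℂ => (Fin.cons z w : Fin (N + 1) → ℂ) :=
  differentiable_pi.mpr <| Fin.cases (by simp) fun i => by simpa using differentiable_apply i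

theorem measure_pi_setOf_measure_cons_ne_zero {N : ℕ} {α : Type*} [MeasurableSpace α]
    {μ : Measure α} [SigmaFinite μ] {S : Set (Fin (N + 1) → α)} (hS : MeasurableSet S)
    (hpos : Measure.pi (fun _ : Fin (N + 1) => μ) S ≠ 0) :
    Measure.pi (fun _ : Fin N => μ) {x | μ {a | Fin.cons a x ∈ S} ≠ 0} ≠ 0 := by
  set e := (MeasurableEquiv.piFinSuccAbove (fun _ : Fin (N + 1) => α) 0).symm
  have hmp : MeasurePreserving e (μ.prod (Measure.pi fun _ : Fin N => μ)) _ :=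
    (measurePreserving_piFinSuccAbove (fun _ : Fin (N + 1) => μ) 0).symm
  have he : ∀ x, e x = Fin.cons x.1 x.2 := fun x => by
    simp [e, MeasurableEquiv.piFinSuccAbove_symm_apply, Fin.insertNthEquiv]
  have hS' : MeasurableSet (e ⁻¹' S) := e.measurable hS
  intro h0
  refine hpos ?_
  rw [← hmp.measure_preimage_equiv, ← Measure.measurePreserving_swap.measure_preimage
    hS'.nullMeasurableSet, Measure.measure_prod_null (measurable_swap hS'), EventuallyEq, ae_iff]
  exact measure_mono_null (fun x hx => by simpa [preimage, he] using hx) h0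

/-- The slice at a point `w` of the torus misses the open polydisc: it is the locally uniform limit
of the slices at `s • w` as `s → 1⁻`. -/
theorem differentiableOn_comp_cons {N : ℕ} {k : (Fin (N + 1) → ℂ) → ℂ}
    (hc : ContinuousOn k (closedBall 0 1)) (hd : DifferentiableOn ℂ k (ball 0 1))
    {w : Fin N → ℂ} (hw : w ∈ closedBall 0 1) :
    DifferentiableOn ℂ (fun z => k (Fin.cons z w)) (ball 0 1) := by
  have hw1 : ‖w‖ ≤ 1 := mem_closedBall_zero_iff.mp hw
  have hnorm : ∀ s ∈ Ioo (0 : ℝ) 1, ‖(s : ℂ) • w‖ < 1 := fun s hs => by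
    rw [norm_smul, Complex.norm_real, Real.norm_of_nonneg hs.1.le]
    exact (mul_le_of_le_one_right hs.1.le hw1).trans_lt hs.2
  have huc := Metric.uniformContinuousOn_iff.mp
    ((isCompact_closedBall (0 : Fin (N + 1) → ℂ) 1).uniformContinuousOn_of_continuous hc)
  have hlim : TendstoUniformlyOn (fun (s : ℝ) (z : ℂ) => k (Fin.cons z ((s : ℂ) • w)))
      (fun z => k (Fin.cons z w)) (𝓝[<] 1) (ball 0 1) := by
    refine Metric.tendstoUniformlyOn_iff.mpr fun ε hε => ?_
    obtain ⟨δ, hδ, hkδ⟩ := huc ε hε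
    have hdist : Tendsto (fun s : ℝ => dist w ((s : ℂ) • w)) (𝓝[<] 1) (𝓝 0) := by
      have : Continuous fun s : ℝ => dist w ((s : ℂ) • w) := by fun_prop
      simpa using (this.tendsto 1).mono_left (nhdsWithin_le_nhds (s := Iio 1))
    filter_upwards [hdist.eventually_lt_const hδ, Ioo_mem_nhdsLT one_pos] with s hs hs1 z hz
    have hz' := ball_subset_closedBall hz
    refine hkδ _ (cons_mem_closedBall_zero_one_iff.mpr ⟨hz', hw⟩) _
      (cons_mem_closedBall_zero_one_iff.mpr
        ⟨hz', mem_closedBall_zero_iff.mpr (hnorm s hs1).le⟩) ?_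
    refine (dist_pi_lt_iff hδ).mpr (Fin.cases (by simpa using hδ) fun i => ?_)
    simpa using (dist_le_pi_dist w ((s : ℂ) • w) i).trans_lt hs
  refine hlim.tendstoLocallyUniformlyOn.differentiableOn ?_ isOpen_ball
  filter_upwards [Ioo_mem_nhdsLT one_pos] with s hs
  exact hd.comp (differentiable_finCons_left _).differentiableOn fun z hz =>
    cons_mem_ball_zero_one_iff.mpr ⟨hz, mem_ball_zero_iff.mpr (hnorm s hs)⟩

theorem eq_zero_of_volume_zeros_torus_ne_zero {N : ℕ} {k : (Fin N → ℂ) → ℂ}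
    (hc : ContinuousOn k (closedBall 0 1)) (hd : DifferentiableOn ℂ k (ball 0 1))
    (hpos : (Measure.pi fun _ : Fin N => volume.restrict (Ioc 0 (2 * π)))
      {θ : Fin N → ℝ | k (fun j => circleMap 0 1 (θ j)) = 0} ≠ 0) :
    ∀ ζ ∈ closedBall (0 : Fin N → ℂ) 1, k ζ = 0 := by
  induction N with
  | zero =>
    intro ζ _
    obtain ⟨θ, hθ⟩ := nonempty_of_measure_ne_zero hpos
    rw [← hθ, Subsingleton.elim ζ]
  | succ N ih =>
    set Z : Set (Fin (N + 1) → ℝ) := {θ | k (fun j => circleMap 0 1 (θ j)) = 0}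
    have hZ : MeasurableSet Z :=
      (isClosed_singleton.preimage (hc.comp_continuous (by fun_prop)
        circleMap_zero_one_mem_closedBall)).measurableSet
    have hcons : ∀ θ₀ (θ : Fin N → ℝ), (Fin.cons (circleMap 0 1 θ₀)
        (fun j => circleMap 0 1 (θ j)) : Fin (N + 1) → ℂ) =
        fun j => circleMap 0 1 ((Fin.cons θ₀ θ : Fin (N + 1) → ℝ) j) := fun θ₀ θ =>
      funext <| Fin.cases (by simp) fun i => by simp
    have hslice : ∀ θ ∈ {θ : Fin N → ℝ | volume.restrict (Ioc 0 (2 * π))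
        {θ₀ | Fin.cons θ₀ θ ∈ Z} ≠ 0}, ∀ z ∈ closedBall (0 : ℂ) 1,
        k (Fin.cons z fun j => circleMap 0 1 (θ j)) = 0 := fun θ hθ => by
      have hθ1 := circleMap_zero_one_mem_closedBall θ
      refine eq_zero_of_volume_zeros_circle_ne_zero ?_ (differentiableOn_comp_cons hc hd hθ1) ?_
      · exact hc.comp (by fun_prop) fun z hz => cons_mem_closedBall_zero_one_iff.mpr ⟨hz, hθ1⟩
      · simp only [hcons]
        exact hθ
    have hball : EqOn k 0 (ball 0 1) := fun ζ hζ => by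
      rw [← Fin.cons_self_tail ζ] at hζ ⊢
      obtain ⟨hz, hw⟩ := cons_mem_ball_zero_one_iff.mp hζ
      refine ih (k := fun w => k (Fin.cons (ζ 0) w)) ?_ ?_ (fun h0 => ?_) _
        (ball_subset_closedBall hw)
      · exact hc.comp (by fun_prop) fun w hw =>
          cons_mem_closedBall_zero_one_iff.mpr ⟨ball_subset_closedBall hz, hw⟩
      · exact hd.comp (differentiable_finCons_right _).differentiableOn fun w hw =>
          cons_mem_ball_zero_one_iff.mpr ⟨hz, hw⟩
      · exact measure_pi_setOf_measure_cons_ne_zero hZ hpos (measure_mono_null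
          (fun θ hθ => hslice θ hθ _ (ball_subset_closedBall hz)) h0)
    exact hball.of_subset_closure hc continuousOn_const ball_subset_closedBall
      (closure_ball (0 : Fin (N + 1) → ℂ) one_ne_zero).ge

end TorusUniqueness

section ComplexMatrix

variable {n : ℕ}

/-- The complex matrix of a real linear map of `ℂⁿ`. It represents the map only if the latter is
complex linear; taking real linear maps makes it available for the real differential of `Φ`, which
also exists at boundary points. -/
noncomputable def complexMatrix (L : Cn n →L[ℝ] Cn n) : Matrix (Fin n) (Fin n) ℂ :=
  Matrix.of fun j k => L (EuclideanSpace.single k 1) j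

theorem continuous_complexMatrix : Continuous (complexMatrix (n := n)) := by
  refine continuous_matrix fun j k => ?_
  simp only [complexMatrix, Matrix.of_apply]
  fun_prop

theorem toEuclideanCLM_complexMatrix {L : Cn n →L[ℝ] Cn n}
    (hL : ∀ (c : ℂ) (v : Cn n), L (c • v) = c • L v) (v : Cn n) :
    Matrix.toEuclideanCLM (𝕜 := ℂ) (complexMatrix L) v = L v := by
  have hv : v = ∑ k, v k • EuclideanSpace.single k (1 : ℂ) := by
    ext j
    simp [Finset.sum_apply, Pi.single_apply]
  ext j
  conv_rhs => rw [hv, map_sum]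
  simp only [hL, Matrix.ofLp_toEuclideanCLM, complexMatrix, Matrix.mulVec, dotProduct,
    Matrix.of_apply]
  simp [mul_comm]

theorem injective_of_complexMatrix_det_ne_zero {L : Cn n →L[ℝ] Cn n}
    (hL : ∀ (c : ℂ) (v : Cn n), L (c • v) = c • L v) (hdet : (complexMatrix L).det ≠ 0) :
    Function.Injective L := by
  refine (injective_iff_map_eq_zero L).mpr fun v hv => ?_
  rw [← toEuclideanCLM_complexMatrix hL] at hv
  have hmul : (complexMatrix L).mulVec v.ofLp = 0 := by
    rw [← Matrix.ofLp_toEuclideanCLM, hv, WithLp.ofLp_zero]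
  ext j
  exact congrFun (Matrix.eq_zero_of_mulVec_eq_zero hdet hmul) j

theorem det_eq_zero_of_complexMatrix_det_eq_zero {L : Cn n →L[ℝ] Cn n}
    (hL : ∀ (c : ℂ) (v : Cn n), L (c • v) = c • L v) (hdet : (complexMatrix L).det = 0) :
    L.det = 0 := by
  obtain ⟨v, hv, hv0⟩ := Matrix.exists_mulVec_eq_zero_iff.mpr hdet
  have hLv : L (WithLp.toLp 2 v) = 0 := by
    rw [← toEuclideanCLM_complexMatrix hL, Matrix.toEuclideanCLM_toLp, hv0, WithLp.toLp_zero]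
  by_contra hne
  have hinj : Function.Injective (L : Cn n →ₗ[ℝ] Cn n) :=
    (LinearMap.equivOfDetNeZero (L : Cn n →ₗ[ℝ] Cn n) hne).injective
  have hv2 : WithLp.toLp 2 v = (0 : Cn n) := hinj (by simpa using hLv)
  exact hv (by simpa using congrArg WithLp.ofLp hv2)

theorem apply_adjugate_complexMatrix {L : Cn n →L[ℝ] Cn n}
    (hL : ∀ (c : ℂ) (v : Cn n), L (c • v) = c • L v) (v : Cn n) :
    L (Matrix.toEuclideanCLM (𝕜 := ℂ) (complexMatrix L).adjugate v)
      = (complexMatrix L).det • v := by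
  rw [← toEuclideanCLM_complexMatrix hL]
  ext j
  simp [Matrix.ofLp_toEuclideanCLM, Matrix.mul_adjugate, Matrix.smul_mulVec]

theorem complexMatrix_det_restrictScalars (L : Cn n →L[ℂ] Cn n) :
    (complexMatrix (L.restrictScalars ℝ)).det = L.det := by
  have hmatrix : complexMatrix (L.restrictScalars ℝ)
      = LinearMap.toMatrix (EuclideanSpace.basisFun (Fin n) ℂ).toBasis
        (EuclideanSpace.basisFun (Fin n) ℂ).toBasis (L : Cn n →ₗ[ℂ] Cn n) := by
    ext j k
    simp [complexMatrix, LinearMap.toMatrix_apply]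
  rw [hmatrix, LinearMap.det_toMatrix, ContinuousLinearMap.det]

theorem continuous_toEuclideanCLM :
    Continuous fun M : Matrix (Fin n) (Fin n) ℂ =>
      (Matrix.toEuclideanCLM (𝕜 := ℂ) M : Cn n →L[ℂ] Cn n) :=
  LinearMap.continuous_of_finiteDimensional
    (Matrix.toEuclideanCLM (n := Fin n) (𝕜 := ℂ)).toAlgEquiv.toLinearMap

theorem differentiableOn_matrix_det {𝕜 E ι : Type*} [NontriviallyNormedField 𝕜]
    [NormedAddCommGroup E] [NormedSpace 𝕜 E] [Fintype ι] [DecidableEq ι] {A : E → Matrix ι ι 𝕜}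
    {s : Set E} (hA : ∀ i j, DifferentiableOn 𝕜 (fun z => A z i j) s) :
    DifferentiableOn 𝕜 (fun z => (A z).det) s := by
  simp only [Matrix.det_apply]
  exact DifferentiableOn.fun_sum fun π _ => DifferentiableOn.const_smul
    (fun z hz => (HasFDerivWithinAt.finsetProd fun i _ =>
      (hA (π i) i z hz).hasFDerivWithinAt).differentiableWithinAt) _

end ComplexMatrix

section OffZeros

theorem norm_le_of_norm_deriv_le_off_zeros {F : Type*} [NormedAddCommGroup F] [NormedSpace ℝ F]
    {f : ℝ → F} {C : ℝ} (hC : 0 ≤ C) (hf : ContinuousOn f (Icc 0 1)) (h0 : f 0 = 0)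
    (hd : ∀ t ∈ Icc (0 : ℝ) 1, f t ≠ 0 → ∃ f', HasDerivAt f f' t ∧ ‖f'‖ ≤ C) : ‖f 1‖ ≤ C := by
  have hclosed : IsClosed (Icc (0 : ℝ) 1 ∩ f ⁻¹' {0}) :=
    hf.preimage_isClosed_of_isClosed isClosed_Icc isClosed_singleton
  obtain ⟨s, ⟨hs, hfs⟩, hlast⟩ := (isCompact_Icc.of_isClosed_subset hclosed
    inter_subset_left).exists_isGreatest ⟨0, by simp, h0⟩
  rw [mem_preimage, mem_singleton_iff] at hfs
  rcases eq_or_lt_of_le hs.2 with rfl | hs1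
  · rwa [hfs, norm_zero]
  choose! f' hderiv hbound using hd
  have hmid : ∀ t ∈ Ioc s 1, ‖f 1 - f t‖ ≤ C := fun t ht => by
    have hoff : ∀ u ∈ Icc t 1, u ∈ Icc (0 : ℝ) 1 ∧ f u ≠ 0 := fun u hu =>
      have hu' : u ∈ Icc (0 : ℝ) 1 := ⟨hs.1.trans (ht.1.le.trans hu.1), hu.2⟩
      ⟨hu', fun hfu => (ht.1.trans_le hu.1).not_ge (hlast ⟨hu', hfu⟩)⟩
    refine (norm_image_sub_le_of_norm_deriv_le_segment' (f' := f') (C := C)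
      (fun u hu => (hderiv u (hoff u hu).1 (hoff u hu).2).hasDerivWithinAt)
      (fun u hu => hbound u (hoff u (Ico_subset_Icc_self hu)).1
        (hoff u (Ico_subset_Icc_self hu)).2) 1 (right_mem_Icc.mpr ht.2)).trans
      (mul_le_of_le_one_right hC ?_)
    linarith [hs.1, ht.1]
  have hlim : Tendsto (fun t => ‖f 1 - f t‖) (𝓝[Ioc s 1] s) (𝓝 ‖f 1 - f s‖) :=
    (tendsto_const_nhds.sub
      ((hf s hs).mono (Ioc_subset_Icc_self.trans (Icc_subset_Icc_left hs.1)))).norm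
  rw [nhdsWithin_Ioc_eq_nhdsGT hs1, hfs, sub_zero] at hlim
  exact le_of_tendsto hlim (eventually_of_mem (Ioc_mem_nhdsGT hs1) hmid)

theorem hasFDerivAt_zero_of_norm_fderiv_le_off_zeros {𝕜 E F : Type*} [RCLike 𝕜]
    [NormedAddCommGroup E] [NormedSpace 𝕜 E] [NormedAddCommGroup F] [NormedSpace 𝕜 F]
    {f : E → F} {a : E} (hcont : ∀ᶠ x in 𝓝 a, ContinuousAt f x) (ha : f a = 0)
    (hd : ∀ ε > 0, ∀ᶠ x in 𝓝 a, f x ≠ 0 → DifferentiableAt 𝕜 f x ∧ ‖fderiv 𝕜 f x‖ ≤ ε) :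
    HasFDerivAt f (0 : E →L[𝕜] F) a := by
  let _ := NormedSpace.restrictScalars ℝ 𝕜 E
  let _ := NormedSpace.restrictScalars ℝ 𝕜 F
  refine hasFDerivAt_iff_isLittleO_nhds_zero.mpr (Asymptotics.isLittleO_iff.mpr fun ε hε => ?_)
  obtain ⟨δ, hδ, hball⟩ := Metric.eventually_nhds_iff_ball.mp (hcont.and (hd ε hε))
  filter_upwards [Metric.ball_mem_nhds (0 : E) hδ] with v hv
  have hseg : ∀ t ∈ Icc (0 : ℝ) 1, a + t • v ∈ Metric.ball a δ := fun t ht => by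
    rw [mem_ball_iff_norm, add_sub_cancel_left, norm_smul, Real.norm_of_nonneg ht.1]
    exact (mul_le_of_le_one_left (norm_nonneg _) ht.2).trans_lt (mem_ball_zero_iff.mp hv)
  have hline : ∀ t : ℝ, HasDerivAt (fun t : ℝ => a + t • v) v t := fun t => by
    simpa using ((hasDerivAt_id t).smul_const v).const_add a
  have hcontline : ContinuousOn (f ∘ fun t : ℝ => a + t • v) (Icc 0 1) := fun t ht =>
    (ContinuousAt.comp (f := fun t : ℝ => a + t • v) (x := t) (hball _ (hseg t ht)).1
      (hline t).continuousAt).continuousWithinAt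
  have hmain := norm_le_of_norm_deriv_le_off_zeros (C := ε * ‖v‖) (by positivity) hcontline
    (by simpa using ha) fun t ht hne => by
      obtain ⟨hdiff, hle⟩ := (hball _ (hseg t ht)).2 hne
      have hderiv : HasFDerivAt f ((fderiv 𝕜 f (a + t • v)).restrictScalars ℝ) (a + t • v) :=
        hdiff.hasFDerivAt.restrictScalars ℝ
      exact ⟨fderiv 𝕜 f (a + t • v) v, hderiv.comp_hasDerivAt t (hline t),
        ContinuousLinearMap.le_of_opNorm_le _ hle v⟩
  simpa [ha] using hmain

end OffZeros

/-- The determinant on unitary maps, as a homomorphism. -/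
noncomputable def unitaryDet {n : ℕ} : (Cn n ≃ₗᵢ[ℂ] Cn n) →* ℂ where
  toFun τ := LinearMap.det (τ.toLinearEquiv : Cn n →ₗ[ℂ] Cn n)
  map_one' := LinearMap.det_id
  map_mul' σ τ := by
    rw [← LinearMap.det_comp]
    rfl

namespace QuotientQuadruple

variable {n : ℕ} (Q : QuotientQuadruple n)

theorem isOpen_X : IsOpen Q.X := by
  rcases Q.model with ⟨hX, -⟩ | ⟨hX, -⟩
  · have hinter : Q.X = ⋂ j, {z : Cn n | ‖z j‖ < 1} := by
      rw [hX]
      ext z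
      simp [unitPolydisc]
    rw [hinter]
    exact isOpen_iInter_of_finite fun j => isOpen_lt (by fun_prop) continuous_const
  · exact hX.1

theorem card_pos : 0 < Nat.card Q.G := by
  have := Q.finite_G
  exact Nat.card_pos

theorem Φ_mem {z : Cn n} (hz : z ∈ Q.X) : Q.Φ z ∈ Q.Ω :=
  Q.image_Φ ▸ mem_image_of_mem _ hz

theorem exists_Φ_eq {w : Cn n} (hw : w ∈ Q.Ω) : ∃ z ∈ Q.X, Q.Φ z = w := by
  rwa [← Q.image_Φ] at hw

theorem Φ_apply {τ : Cn n ≃ₗᵢ[ℂ] Cn n} (hτ : τ ∈ Q.G) {z : Cn n} (hz : z ∈ Q.X) :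
    Q.Φ (τ z) = Q.Φ z :=
  (Q.fibre_X z hz _ (Q.invariant_X τ hτ z hz)).mpr ⟨τ, hτ, rfl⟩

theorem Γ_subset_closure : Q.Γ ⊆ closure Q.X := by
  intro z hz
  have hlim : Tendsto (fun r : ℝ => (r : ℂ) • z) (𝓝[<] 1) (𝓝 z) := by
    have : Continuous fun r : ℝ => (r : ℂ) • z := by fun_prop
    simpa using (this.tendsto 1).mono_left (nhdsWithin_le_nhds (s := Iio 1))
  refine mem_closure_of_tendsto hlim ?_
  filter_upwards [Ioo_mem_nhdsLT one_pos] with r hr using Q.smul_mem hz hr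

theorem contDiffAt_Φ {z : Cn n} (hz : z ∈ closure Q.X) : ContDiffAt ℝ ∞ Q.Φ z := by
  obtain ⟨U, hU, hXU, h⟩ := Q.smooth_Φ
  exact h.contDiffAt (hU.mem_nhds (hXU hz))

theorem differentiableAt_Φ {z : Cn n} (hz : z ∈ Q.X) : DifferentiableAt ℂ Q.Φ z :=
  Q.holomorphic_Φ.differentiableAt (Q.isOpen_X.mem_nhds hz)

theorem fderiv_real_Φ {z : Cn n} (hz : z ∈ Q.X) :
    fderiv ℝ Q.Φ z = (fderiv ℂ Q.Φ z).restrictScalars ℝ :=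
  (Q.differentiableAt_Φ hz).fderiv_restrictScalars ℝ

theorem continuousAt_fderiv_Φ {z : Cn n} (hz : z ∈ closure Q.X) :
    ContinuousAt (fderiv ℝ Q.Φ) z :=
  (Q.contDiffAt_Φ hz).continuousAt_fderiv (by simp)

theorem fderiv_Φ_smul {z : Cn n} (hz : z ∈ closure Q.X) (c : ℂ) (v : Cn n) :
    fderiv ℝ Q.Φ z (c • v) = c • fderiv ℝ Q.Φ z v := by
  have hcont : ContinuousWithinAt
      (fun z => fderiv ℝ Q.Φ z (c • v) - c • fderiv ℝ Q.Φ z v) Q.X z := by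
    have h := (Q.continuousAt_fderiv_Φ hz).continuousWithinAt (s := Q.X)
    exact (h.clm_apply continuousWithinAt_const).sub
      ((h.clm_apply continuousWithinAt_const).const_smul c)
  have hmem := hcont.mem_closure (t := {0}) hz fun y hy => by simp [Q.fderiv_real_Φ hy]
  simpa [sub_eq_zero] using hmem

theorem hasStrictFDerivAt_Φ {z : Cn n} (hz : z ∈ Q.X) :
    HasStrictFDerivAt Q.Φ (fderiv ℂ Q.Φ z) z := by
  have h := (Q.contDiffAt_Φ (subset_closure hz)).hasStrictFDerivAt (by simp)
  rw [Q.fderiv_real_Φ hz] at h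
  exact HasStrictFDerivAt.of_isLittleO h.isLittleO

/-- The complex Jacobian determinant of `Φ`, up to the boundary of `X`. -/
noncomputable def jac (z : Cn n) : ℂ := (complexMatrix (fderiv ℝ Q.Φ z)).det

/-- The adjugate of the complex differential of `Φ`. -/
noncomputable def adjΦ (z : Cn n) : Cn n →L[ℂ] Cn n :=
  Matrix.toEuclideanCLM (𝕜 := ℂ) (complexMatrix (fderiv ℝ Q.Φ z)).adjugate

theorem continuousAt_jac {z : Cn n} (hz : z ∈ closure Q.X) : ContinuousAt Q.jac z :=
  ContinuousAt.comp (g := fun L => (complexMatrix L).det)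
    continuous_complexMatrix.matrix_det.continuousAt (Q.continuousAt_fderiv_Φ hz)

theorem continuousAt_adjΦ {z : Cn n} (hz : z ∈ closure Q.X) : ContinuousAt Q.adjΦ z :=
  ContinuousAt.comp (g := fun L => (Matrix.toEuclideanCLM (𝕜 := ℂ)
    (complexMatrix L).adjugate : Cn n →L[ℂ] Cn n))
    (continuous_toEuclideanCLM.comp continuous_complexMatrix.matrix_adjugate).continuousAt
    (Q.continuousAt_fderiv_Φ hz)

theorem jac_eq_det {z : Cn n} (hz : z ∈ Q.X) : Q.jac z = (fderiv ℂ Q.Φ z).det := by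
  rw [jac, Q.fderiv_real_Φ hz, complexMatrix_det_restrictScalars]

theorem fderiv_Φ_adjΦ {z : Cn n} (hz : z ∈ Q.X) (v : Cn n) :
    fderiv ℂ Q.Φ z (Q.adjΦ z v) = Q.jac z • v := by
  rw [jac, adjΦ, ← apply_adjugate_complexMatrix (Q.fderiv_Φ_smul (subset_closure hz)) v,
    Q.fderiv_real_Φ hz, ContinuousLinearMap.coe_restrictScalars']

theorem differentiableOn_jac : DifferentiableOn ℂ Q.jac Q.X := by
  refine differentiableOn_matrix_det fun j k => ?_
  have hentry := (EuclideanSpace.proj (𝕜 := ℂ) j).differentiable.comp_differentiableOn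
    (differentiableOn_fderiv_apply Q.isOpen_X Q.holomorphic_Φ (EuclideanSpace.single k 1))
  refine hentry.congr fun z hz => ?_
  simp [complexMatrix, Q.fderiv_real_Φ hz]

theorem jac_eq_jac_apply_mul_unitaryDet {τ : Cn n ≃ₗᵢ[ℂ] Cn n} (hτ : τ ∈ Q.G) {z : Cn n}
    (hz : z ∈ Q.X) : Q.jac z = Q.jac (τ z) * unitaryDet τ := by
  have hτz := Q.invariant_X τ hτ z hz
  have hΦ : Q.Φ =ᶠ[𝓝 z] Q.Φ ∘ τ := by
    filter_upwards [Q.isOpen_X.mem_nhds hz] with y hy using (Q.Φ_apply hτ hy).symm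
  have hchain : fderiv ℂ Q.Φ z =
      (fderiv ℂ Q.Φ (τ z)).comp (τ.toContinuousLinearEquiv : Cn n →L[ℂ] Cn n) := by
    rw [hΦ.fderiv_eq]
    exact ((Q.differentiableAt_Φ hτz).hasFDerivAt.comp z
      (τ.toContinuousLinearEquiv : Cn n →L[ℂ] Cn n).hasFDerivAt).fderiv
  rw [Q.jac_eq_det hz, Q.jac_eq_det hτz, hchain, ContinuousLinearMap.det, ContinuousLinearMap.det]
  exact LinearMap.det_comp _ _

theorem jac_pow_card {τ : Cn n ≃ₗᵢ[ℂ] Cn n} (hτ : τ ∈ Q.G) {z : Cn n} (hz : z ∈ Q.X) :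
    Q.jac (τ z) ^ Nat.card Q.G = Q.jac z ^ Nat.card Q.G := by
  have hpow : τ ^ Nat.card Q.G = 1 :=
    congrArg Subtype.val (pow_card_eq_one' (x := (⟨τ, hτ⟩ : Q.G)))
  rw [Q.jac_eq_jac_apply_mul_unitaryDet hτ hz, mul_pow, ← map_pow, hpow, map_one, mul_one]

theorem image_mem_nhds {z : Cn n} (hz : z ∈ Q.X) {V : Set (Cn n)} (hV : V ∈ 𝓝 z) :
    Q.Φ '' V ∈ 𝓝 (Q.Φ z) := by
  obtain ⟨V', hV', hopen, hzV⟩ := mem_nhds_iff.mp (inter_mem hV (Q.isOpen_X.mem_nhds hz))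
  obtain ⟨ρ, hρ, hball⟩ := Metric.nhds_basis_closedBall.mem_iff.mp
    (Q.isOpen_Ω.mem_nhds (Q.Φ_mem hz))
  -- Points of `X` over a small ball either lie in the saturation `W` of `V'` or in a compact set
  -- whose image misses `Φ z`.
  set W : Set (Cn n) := ⋃ τ ∈ Q.G, τ ⁻¹' V'
  set C : Set (Cn n) := (Q.X ∩ Q.Φ ⁻¹' Metric.closedBall (Q.Φ z) ρ) \ W
  have hW : IsOpen W := isOpen_biUnion fun τ _ => hopen.preimage τ.continuous
  have hC : IsCompact C := (Q.proper_Φ _ hball (isCompact_closedBall _ _)).diff hW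
  have himage : IsCompact (Q.Φ '' C) :=
    hC.image_of_continuousOn (Q.holomorphic_Φ.continuousOn.mono fun y hy => hy.1.1)
  have hnot : Q.Φ z ∉ Q.Φ '' C := by
    rintro ⟨y, ⟨⟨hyX, -⟩, hyW⟩, hy⟩
    obtain ⟨τ, hτ, h⟩ := (Q.fibre_X y hyX z hz).mp hy.symm
    exact hyW (mem_biUnion hτ (by rwa [mem_preimage, h]))
  filter_upwards [himage.isClosed.isOpen_compl.mem_nhds hnot, Metric.closedBall_mem_nhds _ hρ]
    with w hw hwball
  obtain ⟨y, hy, rfl⟩ := Q.exists_Φ_eq (hball hwball)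
  have hyW : y ∈ W := by
    by_contra h
    exact hw ⟨y, ⟨⟨hy, hwball⟩, h⟩, rfl⟩
  obtain ⟨τ, hτ, hyτ⟩ := mem_iUnion₂.mp hyW
  exact ⟨τ y, (hV' hyτ).1, Q.Φ_apply hτ hy⟩

theorem map_Φ_nhds {z : Cn n} (hz : z ∈ Q.X) : map Q.Φ (𝓝 z) = 𝓝 (Q.Φ z) :=
  le_antisymm (Q.differentiableAt_Φ hz).continuousAt (le_map fun _ hV => Q.image_mem_nhds hz hV)

theorem exists_jac_ne_zero {V : Set (Cn n)} (hVX : V ⊆ Q.X) (hV : IsOpen V) (hne : V.Nonempty) :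
    ∃ z ∈ V, Q.jac z ≠ 0 := by
  by_contra! h
  obtain ⟨z, hz⟩ := hne
  have hnull : Measure.addHaar (Q.Φ '' V) = 0 := by
    refine addHaar_image_eq_zero_of_det_fderivWithin_eq_zero _
      (f' := fun y => fderiv ℝ Q.Φ y) (fun y hy => ?_) fun y hy => ?_
    · exact (((Q.contDiffAt_Φ (subset_closure (hVX hy))).differentiableAt
        (by simp)).hasFDerivAt).hasFDerivWithinAt
    · exact det_eq_zero_of_complexMatrix_det_eq_zero
        (Q.fderiv_Φ_smul (subset_closure (hVX hy))) (h y hy)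
  exact (Measure.measure_pos_of_mem_nhds _ (Q.image_mem_nhds (hVX hz) (hV.mem_nhds hz))).ne' hnull

/-- A function on `X` that is constant on the fibres of `Φ`, regarded as a function on `Ω`; off `Ω`
it takes a default value. -/
noncomputable def descend {Y : Type*} [Inhabited Y] (F : Cn n → Y) (w : Cn n) : Y :=
  open Classical in if h : ∃ z ∈ Q.X, Q.Φ z = w then F h.choose else default

theorem descend_Φ {Y : Type*} [Inhabited Y] {F : Cn n → Y}
    (hF : ∀ τ ∈ Q.G, ∀ z ∈ Q.X, F (τ z) = F z) {z : Cn n} (hz : z ∈ Q.X) :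
    Q.descend F (Q.Φ z) = F z := by
  have h : ∃ y ∈ Q.X, Q.Φ y = Q.Φ z := ⟨z, hz, rfl⟩
  rw [descend, dif_pos h]
  obtain ⟨τ, hτ, hy⟩ := (Q.fibre_X z hz _ h.choose_spec.1).mp h.choose_spec.2
  rw [← hy, hF τ hτ z hz]

section CompΦ

variable {f F : Cn n → ℂ}

theorem eventuallyEq_comp_Φ (h : ∀ z ∈ Q.X, f (Q.Φ z) = F z) {z : Cn n} (hz : z ∈ Q.X) :
    f ∘ Q.Φ =ᶠ[𝓝 z] F :=
  eventually_of_mem (Q.isOpen_X.mem_nhds hz) h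

theorem continuousOn_of_comp_Φ (hF : ContinuousOn F Q.X) (h : ∀ z ∈ Q.X, f (Q.Φ z) = F z) :
    ContinuousOn f Q.Ω := by
  intro w hw
  obtain ⟨z, hz, rfl⟩ := Q.exists_Φ_eq hw
  refine ContinuousAt.continuousWithinAt ?_
  rw [ContinuousAt, ← Q.map_Φ_nhds hz, tendsto_map'_iff, h z hz]
  exact (hF.continuousAt (Q.isOpen_X.mem_nhds hz)).congr' (Q.eventuallyEq_comp_Φ h hz).symm

theorem differentiableAt_of_comp_Φ (hF : DifferentiableOn ℂ F Q.X)
    (h : ∀ z ∈ Q.X, f (Q.Φ z) = F z) {z : Cn n} (hz : z ∈ Q.X) (hJ : Q.jac z ≠ 0) :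
    DifferentiableAt ℂ f (Q.Φ z) := by
  have hinj : Function.Injective (fderiv ℂ Q.Φ z) := by
    have := injective_of_complexMatrix_det_ne_zero (Q.fderiv_Φ_smul (subset_closure hz)) hJ
    rwa [Q.fderiv_real_Φ hz] at this
  set e : Cn n ≃L[ℂ] Cn n := (LinearEquiv.ofInjectiveEndo
    (fderiv ℂ Q.Φ z : Cn n →ₗ[ℂ] Cn n) hinj).toContinuousLinearEquiv
  have hΦ : HasStrictFDerivAt Q.Φ (e : Cn n →L[ℂ] Cn n) z := Q.hasStrictFDerivAt_Φ hz
  have hlocal : f =ᶠ[𝓝 (Q.Φ z)] F ∘ hΦ.localInverse Q.Φ e z := by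
    filter_upwards [hΦ.eventually_right_inverse,
      hΦ.localInverse_tendsto (Q.isOpen_X.mem_nhds hz)] with w hw hwX
    rw [Function.comp_apply, ← h _ hwX, hw]
  refine (DifferentiableAt.comp _ ?_
    hΦ.to_localInverse.hasFDerivAt.differentiableAt).congr_of_eventuallyEq hlocal
  rw [hΦ.localInverse_apply_image]
  exact hF.differentiableAt (Q.isOpen_X.mem_nhds hz)

theorem jac_mul_fderiv_apply {z : Cn n} (hz : z ∈ Q.X) (hf : DifferentiableAt ℂ f (Q.Φ z))
    (v : Cn n) :
    Q.jac z * fderiv ℂ f (Q.Φ z) v = fderiv ℂ (f ∘ Q.Φ) z (Q.adjΦ z v) := by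
  rw [fderiv_comp z hf (Q.differentiableAt_Φ hz), ContinuousLinearMap.comp_apply,
    Q.fderiv_Φ_adjΦ hz, map_smul, smul_eq_mul]

theorem fderiv_eq_of_comp_Φ_eq_jac_pow {N : ℕ}
    (hf : ∀ z ∈ Q.X, f (Q.Φ z) = Q.jac z ^ (N + 2)) {z : Cn n} (hz : z ∈ Q.X) (hJ : Q.jac z ≠ 0) :
    fderiv ℂ f (Q.Φ z) =
      ((N + 2) * Q.jac z ^ N) • (fderiv ℂ Q.jac z).comp (Q.adjΦ z) := by
  have hJd := Q.differentiableOn_jac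
  have hpow : fderiv ℂ (f ∘ Q.Φ) z = ((N + 2) * Q.jac z ^ (N + 1)) • fderiv ℂ Q.jac z := by
    rw [(Q.eventuallyEq_comp_Φ hf hz).fderiv_eq,
      fderiv_fun_pow _ (hJd.differentiableAt (Q.isOpen_X.mem_nhds hz))]
    simp
  ext v
  have hv := Q.jac_mul_fderiv_apply hz (Q.differentiableAt_of_comp_Φ (hJd.pow _) hf hz hJ) v
  rw [hpow] at hv
  refine mul_left_cancel₀ hJ (hv.trans ?_)
  simp only [smul_apply, ContinuousLinearMap.comp_apply, smul_eq_mul]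
  ring

theorem hasFDerivAt_zero_of_comp_Φ_eq_jac_pow {N : ℕ} (hN : N ≠ 0)
    (hf : ∀ z ∈ Q.X, f (Q.Φ z) = Q.jac z ^ (N + 2)) {z : Cn n} (hz : z ∈ Q.X) (hJ : Q.jac z = 0) :
    HasFDerivAt f (0 : Cn n →L[ℂ] ℂ) (Q.Φ z) := by
  have hJd := Q.differentiableOn_jac
  have hX := Q.isOpen_X.mem_nhds hz
  refine hasFDerivAt_zero_of_norm_fderiv_le_off_zeros ?_ (by simp [hf z hz, hJ]) fun ε hε => ?_
  · filter_upwards [Q.isOpen_Ω.mem_nhds (Q.Φ_mem hz)] with w hw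
    exact (Q.continuousOn_of_comp_Φ (hJd.pow _).continuousOn hf).continuousAt
      (Q.isOpen_Ω.mem_nhds hw)
  have hfderiv : ContinuousAt (fderiv ℂ Q.jac) z :=
    (continuousOn_clm_apply.mpr fun v =>
      (differentiableOn_fderiv_apply Q.isOpen_X hJd v).continuousOn).continuousAt hX
  have hcont : ContinuousAt (fun y =>
      ((N + 2) * Q.jac y ^ N) • (fderiv ℂ Q.jac y).comp (Q.adjΦ y)) z :=
    (continuousAt_const.mul ((Q.continuousAt_jac (subset_closure hz)).pow N)).smul
      (hfderiv.clm_comp (Q.continuousAt_adjΦ (subset_closure hz)))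
  have hsmall : ∀ᶠ y in 𝓝 z,
      ‖((N + 2) * Q.jac y ^ N) • (fderiv ℂ Q.jac y).comp (Q.adjΦ y)‖ < ε :=
    hcont.norm.eventually_lt_const (by
      simp only [hJ, zero_pow hN, mul_zero]
      rwa [zero_smul ℂ ((fderiv ℂ Q.jac z).comp (Q.adjΦ z)), norm_zero])
  rw [← Q.map_Φ_nhds hz, eventually_map]
  filter_upwards [hsmall, hX] with y hy hyX hfy
  have hJy : Q.jac y ≠ 0 := fun h0 => hfy (by simp [hf y hyX, h0])
  refine ⟨Q.differentiableAt_of_comp_Φ (hJd.pow _) hf hyX hJy, ?_⟩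
  rw [Q.fderiv_eq_of_comp_Φ_eq_jac_pow hf hyX hJy]
  exact hy.le

theorem differentiableOn_of_comp_Φ_eq_jac_pow {N : ℕ} (hN : N ≠ 0)
    (hf : ∀ z ∈ Q.X, f (Q.Φ z) = Q.jac z ^ (N + 2)) : DifferentiableOn ℂ f Q.Ω := by
  intro w hw
  obtain ⟨z, hz, rfl⟩ := Q.exists_Φ_eq hw
  refine DifferentiableAt.differentiableWithinAt ?_
  by_cases hJ : Q.jac z = 0
  · exact (Q.hasFDerivAt_zero_of_comp_Φ_eq_jac_pow hN hf hz hJ).differentiableAt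
  · exact Q.differentiableAt_of_comp_Φ (Q.differentiableOn_jac.pow _) hf hz hJ

/-- The critical values of `Φ` lie in the zero set of the holomorphic function on `Ω` induced by
a `G`-invariant power of the Jacobian, and are therefore removable. -/
theorem differentiableOn_descend (hF : DifferentiableOn ℂ F Q.X)
    (hinv : ∀ τ ∈ Q.G, ∀ z ∈ Q.X, F (τ z) = F z) : DifferentiableOn ℂ (Q.descend F) Q.Ω := by
  have hf : ∀ z ∈ Q.X, Q.descend F (Q.Φ z) = F z := fun z hz => Q.descend_Φ hinv hz
  obtain ⟨N, hN, hcard⟩ : ∃ N ≠ 0, Nat.card Q.G * 3 = N + 2 :=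
    ⟨Nat.card Q.G * 3 - 2, by have := Q.card_pos; omega, by have := Q.card_pos; omega⟩
  set e := Q.descend fun z => Q.jac z ^ (N + 2)
  have he : ∀ z ∈ Q.X, e (Q.Φ z) = Q.jac z ^ (N + 2) := fun z hz =>
    Q.descend_Φ (fun τ hτ z hz => by rw [← hcard, pow_mul, pow_mul, Q.jac_pow_card hτ hz]) hz
  refine differentiableOn_of_continuousOn_of_differentiableAt_off_zeros Q.isOpen_Ω
    (Q.continuousOn_of_comp_Φ hF.continuousOn hf)
    (Q.differentiableOn_of_comp_Φ_eq_jac_pow hN he) (fun w hw hew => ?_) fun V hVΩ hV hne => ?_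
  · obtain ⟨z, hz, rfl⟩ := Q.exists_Φ_eq hw
    exact Q.differentiableAt_of_comp_Φ hF hf hz fun h0 => hew (by simp [he z hz, h0])
  · obtain ⟨w, hw⟩ := hne
    obtain ⟨z, hz, rfl⟩ := Q.exists_Φ_eq (hVΩ hw)
    obtain ⟨y, hy, hJy⟩ := Q.exists_jac_ne_zero (V := Q.X ∩ Q.Φ ⁻¹' V) inter_subset_left
      (Q.holomorphic_Φ.continuousOn.isOpen_inter_preimage Q.isOpen_X hV) ⟨z, hz, hw⟩
    exact ⟨Q.Φ y, hy.2, by rw [he y hy.1]; exact pow_ne_zero _ hJy⟩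

end CompΦ

end QuotientQuadruple

section HausdorffMeasure

open Measure

variable {E F : Type*} [EMetricSpace E] [MeasurableSpace E] [BorelSpace E]
  [EMetricSpace F] [MeasurableSpace F] [BorelSpace F]

theorem euclideanHausdorffMeasure_image_le_of_lipschitzOnWith {K : ℝ≥0} {f : E → F} {s : Set E}
    (h : LipschitzOnWith K f s) (d : ℕ) : μHE[d] (f '' s) ≤ (K : ℝ≥0∞) ^ d * μHE[d] s := by
  simp only [euclideanHausdorffMeasure_def, Measure.smul_apply, ENNReal.smul_def, smul_eq_mul]
  rw [mul_left_comm]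
  gcongr
  simpa using h.hausdorffMeasure_image_le (d := (d : ℝ)) (by positivity)

theorem euclideanHausdorffMeasure_image_lt_top_of_isCompact {d : ℕ} {f : E → F} {s : Set E}
    (hs : IsCompact s) (hf : ∀ x ∈ s, ∃ K : ℝ≥0, ∃ t ∈ 𝓝 x, LipschitzOnWith K f t)
    (hfin : μHE[d] s < ⊤) : μHE[d] (f '' s) < ⊤ := by
  choose! K t ht hK using hf
  obtain ⟨u, hu, hsu⟩ := hs.elim_nhds_subcover t ht
  have hcover : f '' s ⊆ ⋃ x ∈ u, f '' (s ∩ t x) := by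
    rintro _ ⟨x, hx, rfl⟩
    obtain ⟨y, hy, hxy⟩ := mem_iUnion₂.mp (hsu hx)
    exact mem_biUnion hy ⟨x, ⟨hx, hxy⟩, rfl⟩
  refine (measure_mono hcover).trans_lt <| (measure_biUnion_finset_le _ _).trans_lt <|
    ENNReal.sum_lt_top.mpr fun x hx => ?_
  exact (euclideanHausdorffMeasure_image_le_of_lipschitzOnWith
    ((hK x (hu x hx)).mono inter_subset_right) d).trans_lt
      (ENNReal.mul_lt_top (by finiteness) ((measure_mono inter_subset_left).trans_lt hfin))

theorem exists_nhds_euclideanHausdorffMeasure_zeros_lt_top {E : Type*} [NormedAddCommGroup E]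
    [NormedSpace ℝ E] [FiniteDimensional ℝ E] [MeasurableSpace E] [BorelSpace E]
    {ρ : E → ℝ} {L : E →L[ℝ] ℝ} {q : E} (hρ : HasStrictFDerivAt ρ L q) (hL : L ≠ 0)
    (hq : ρ q = 0) :
    ∃ V ∈ 𝓝 q, μHE[Module.finrank ℝ E - 1] (V ∩ {x | ρ x = 0}) < ⊤ := by
  have hL' : (L : E →ₗ[ℝ] ℝ) ≠ 0 := fun h => hL (ContinuousLinearMap.coe_injective h)
  have hsurj : L.range = ⊤ := Module.Dual.range_eq_top_of_ne_zero hL'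
  have hrank : Module.finrank ℝ E - 1 = Module.finrank ℝ L.ker :=
    Nat.sub_eq_of_eq_add (Module.Dual.finrank_ker_add_one_of_ne_zero hL').symm
  have := FiniteDimensional.complete ℝ E
  set e := hρ.implicitToOpenPartialHomeomorph ρ L hsurj
  set ψ := hρ.implicitFunction ρ L hsurj 0
  obtain ⟨K, t, ht, hK⟩ := (hq ▸ hρ.to_implicitFunction hsurj :
    HasStrictFDerivAt ψ _ 0).exists_lipschitzOnWith
  obtain ⟨ε, hε, hball⟩ := Metric.nhds_basis_closedBall.mem_iff.mp ht
  have hparam : Tendsto (fun x => (e x).2) (𝓝 q) (𝓝 0) := by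
    have h := continuous_snd.continuousAt.tendsto.comp
      (e.continuousAt (hρ.mem_implicitToOpenPartialHomeomorph_source hsurj)).tendsto
    rwa [hρ.implicitToOpenPartialHomeomorph_self hsurj] at h
  refine ⟨_, inter_mem (hρ.eq_implicitFunction hsurj)
    (hparam (Metric.closedBall_mem_nhds 0 hε)), ?_⟩
  have hsub : {x | hρ.implicitFunction ρ L hsurj (ρ x) (e x).2 = x} ∩
      (fun x => (e x).2) ⁻¹' Metric.closedBall 0 ε ∩ {x | ρ x = 0} ⊆
        ψ '' Metric.closedBall 0 ε := by
    rintro x ⟨⟨(hx : _ = x), hxε⟩, (hρx : ρ x = 0)⟩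
    exact ⟨_, hxε, by rwa [hρx] at hx⟩
  refine (measure_mono hsub).trans_lt
    ((euclideanHausdorffMeasure_image_le_of_lipschitzOnWith (hK.mono hball) _).trans_lt
      (ENNReal.mul_lt_top (by finiteness) ?_))
  rw [hrank]
  exact (isCompact_closedBall _ _).measure_lt_top

theorem euclideanHausdorffMeasure_unitTorus_lt_top (n : ℕ) : μHE[n] (unitTorus n) < ⊤ := by
  set f : EuclideanSpace ℝ (Fin n) → Cn n := fun θ =>
    WithLp.toLp 2 fun j => Complex.exp (θ j * Complex.I) with hf
  set s : Set (EuclideanSpace ℝ (Fin n)) :=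
    WithLp.toLp 2 '' (univ.pi fun _ : Fin n => Icc (-Real.pi) Real.pi)
  have hs : IsCompact s :=
    (isCompact_univ_pi fun _ => isCompact_Icc).image (PiLp.continuous_toLp 2 _)
  have hcover : unitTorus n ⊆ f '' s := by
    intro z hz
    refine ⟨WithLp.toLp 2 fun j => (z j).arg, ⟨_, fun j _ => ?_, rfl⟩, ?_⟩
    · exact ⟨(Complex.neg_pi_lt_arg _).le, Complex.arg_le_pi _⟩
    · ext j
      have := Complex.norm_mul_exp_arg_mul_I (z j)
      rw [hz j] at this
      simpa [hf] using this
  have hsmooth : ContDiff ℝ 1 f := by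
    refine (contDiff_piLp 2).mpr fun j => ?_
    have : ContDiff ℝ 1 fun θ : EuclideanSpace ℝ (Fin n) => (θ j : ℂ) :=
      Complex.ofRealCLM.contDiff.comp (EuclideanSpace.proj (𝕜 := ℝ) j).contDiff
    simp only [hf]
    fun_prop
  refine (measure_mono hcover).trans_lt (euclideanHausdorffMeasure_image_lt_top_of_isCompact hs
    (fun x _ => hsmooth.contDiffAt.exists_lipschitzOnWith) ?_)
  rw [EuclideanSpace.euclideanHausdorffMeasure_eq_volume]
  exact hs.measure_lt_top

theorem eq_zero_of_mem_frontier {E : Type*} [TopologicalSpace E] {X U : Set E} {ρ : E → ℝ}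
    (hX : IsOpen X) (hU : IsOpen U) (hρ : ContinuousOn ρ U) (hXU : X ∩ U = {z ∈ U | ρ z < 0})
    {x : E} (hx : x ∈ frontier X) (hxU : x ∈ U) : ρ x = 0 := by
  apply le_antisymm
  · have hcl : x ∈ closure (X ∩ U) :=
      hU.closure_inter ⟨frontier_subset_closure hx, hxU⟩
    have hle := ((hρ x hxU).mono inter_subset_right).mem_closure (t := Iic 0) hcl fun y hy =>
      (hXU.subset hy).2.le
    simpa using hle
  · by_contra! hneg
    rw [hX.frontier_eq] at hx
    exact hx.2 (hXU.superset ⟨hxU, hneg⟩).1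

theorem finrank_real_Cn (n : ℕ) : Module.finrank ℝ (Cn n) = 2 * n := by
  rw [finrank_real_of_complex, finrank_euclideanSpace_fin]

theorem euclideanHausdorffMeasure_frontier_lt_top {n : ℕ} {X : Set (Cn n)}
    (hXo : IsOpen X) (hXb : Bornology.IsBounded X) (hX : HasC2Boundary X) :
    μHE[2 * n - 1] (frontier X) < ⊤ := by
  have hcompact : IsCompact (frontier X) :=
    hXb.isCompact_closure.of_isClosed_subset isClosed_frontier frontier_subset_closure
  refine hcompact.measure_lt_top_of_nhdsWithin fun q hq => ?_
  obtain ⟨U, hU, hqU, ρ, hρ, hdρ, hXU⟩ := hX q hq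
  have hzero : ∀ x ∈ frontier X, x ∈ U → ρ x = 0 := fun x =>
    eq_zero_of_mem_frontier hXo hU hρ.continuousOn hXU
  obtain ⟨V, hV, hfin⟩ := exists_nhds_euclideanHausdorffMeasure_zeros_lt_top
    ((hρ.contDiffAt (hU.mem_nhds hqU)).hasStrictFDerivAt (by simp)) hdρ (hzero q hq hqU)
  rw [finrank_real_Cn] at hfin
  refine ⟨frontier X ∩ (V ∩ U), inter_mem_nhdsWithin _ (inter_mem hV (hU.mem_nhds hqU)), ?_⟩
  have hsub : frontier X ∩ (V ∩ U) ⊆ V ∩ {x | ρ x = 0} := fun x hx =>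
    ⟨hx.2.1, hzero x hx.1 hx.2.2⟩
  exact (measure_mono hsub).trans_lt hfin

theorem euclideanHausdorffMeasure_coordinate_hyperplane {n : ℕ} (j : Fin n) :
    μHE[2 * n - 1] {z : Cn n | z j = 0} = 0 := by
  set l : Module.Dual ℂ (Cn n) := (EuclideanSpace.proj j : Cn n →L[ℂ] ℂ).toLinearMap
  have hl : l ≠ 0 := fun h => one_ne_zero (α := ℂ) <| by
    simpa [l] using congrArg (fun l : Module.Dual ℂ (Cn n) => l (EuclideanSpace.single j 1)) h
  have hrank : Module.finrank ℝ (LinearMap.ker l) < 2 * n - 1 := by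
    have h := Module.Dual.finrank_ker_add_one_of_ne_zero hl
    rw [finrank_euclideanSpace_fin] at h
    rw [finrank_real_of_complex]
    have := Fin.pos j
    omega
  have hset : {z : Cn n | z j = 0} = (fun x : LinearMap.ker l => (x : Cn n)) '' univ := by
    ext z
    simp [l]
  have hzero : (μH[((2 * n - 1 : ℕ) : ℝ)] : Measure (LinearMap.ker l)) = 0 :=
    Real.hausdorffMeasure_of_finrank_lt (by exact_mod_cast hrank)
  rw [hset, isometry_subtype_coe.euclideanHausdorffMeasure_image, euclideanHausdorffMeasure_def,
    Measure.smul_apply, hzero]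
  simp

end HausdorffMeasure

theorem measure_eq_zero_of_ae_measure_orbit_eq_zero {α β : Type*} [MeasurableSpace α]
    [MeasurableSpace β] {μ : Measure α} [SFinite μ] {ν : Measure β} [SFinite ν] [NeZero ν]
    {T : β → α → α} (hT : Measurable fun x : α × β => T x.2 x.1)
    (hmp : ∀ b, MeasurePreserving (T b) μ μ) {Z : Set α} (hZ : MeasurableSet Z)
    (h : ∀ᵐ a ∂μ, ν {b | T b a ∈ Z} = 0) : μ Z = 0 := by
  have hS : MeasurableSet {x : α × β | T x.2 x.1 ∈ Z} := hT hZ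
  have hprod : (μ.prod ν) {x : α × β | T x.2 x.1 ∈ Z} = 0 := (Measure.measure_prod_null hS).mpr h
  rw [← Measure.measurePreserving_swap.measure_preimage hS.nullMeasurableSet,
    Measure.measure_prod_null (measurable_swap hS)] at hprod
  obtain ⟨b, hb⟩ := hprod.exists
  exact ((hmp b).measure_preimage hZ.nullMeasurableSet).symm.trans hb

section CoordinateRotation

variable {n : ℕ}

/-- Multiplication of the coordinates of `z` by those of `ζ`, as a map into Euclidean space. -/
noncomputable def coordinateMul (z : Cn n) (ζ : Fin n → ℂ) : Cn n :=
  WithLp.toLp 2 fun j => ζ j * z j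

theorem coordinateMul_apply (z : Cn n) (ζ : Fin n → ℂ) (j : Fin n) :
    coordinateMul z ζ j = ζ j * z j := rfl

theorem continuous_coordinateMul :
    Continuous fun x : Cn n × (Fin n → ℂ) => coordinateMul x.1 x.2 :=
  (PiLp.continuous_toLp 2 _).comp (by fun_prop)

theorem differentiable_coordinateMul (z : Cn n) : Differentiable ℂ (coordinateMul z) := by
  refine (differentiable_piLp 2).mpr fun j => ?_
  simp only [coordinateMul_apply]
  fun_prop

theorem exists_coordinateMul_eq {z y : Cn n} (h : ∀ j, ‖y j‖ < ‖z j‖) :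
    ∃ ζ ∈ Metric.ball (0 : Fin n → ℂ) 1, coordinateMul z ζ = y := by
  have hz : ∀ j, 0 < ‖z j‖ := fun j => (norm_nonneg _).trans_lt (h j)
  refine ⟨fun j => y j / z j, ?_, ?_⟩
  · rw [mem_ball_zero_iff, pi_norm_lt_iff one_pos]
    intro j
    rw [norm_div, div_lt_one (hz j)]
    exact h j
  · ext j
    exact div_mul_cancel₀ _ (norm_pos_iff.mp (hz j))

/-- The action of the torus on `ℂⁿ` by rotation of the coordinates. -/
noncomputable def coordinateRotation (θ : Fin n → ℝ) : Cn n ≃ₗᵢ[ℝ] Cn n :=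
  LinearIsometryEquiv.piLpCongrRight 2 fun j => rotation (Circle.exp (θ j))

theorem coordinateRotation_eq (θ : Fin n → ℝ) (z : Cn n) :
    coordinateRotation θ z = coordinateMul z fun j => circleMap 0 1 (θ j) := by
  ext j
  simp [coordinateRotation, coordinateMul_apply, circleMap]

theorem norm_coordinateRotation_apply (θ : Fin n → ℝ) (z : Cn n) (j : Fin n) :
    ‖coordinateRotation θ z j‖ = ‖z j‖ := by
  simp [coordinateRotation_eq, coordinateMul_apply]

theorem continuous_coordinateRotation :
    Continuous fun x : Cn n × (Fin n → ℝ) => coordinateRotation x.2 x.1 := by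
  simp only [coordinateRotation_eq]
  have := continuous_circleMap 0 1
  exact continuous_coordinateMul.comp (by fun_prop :
    Continuous fun x : Cn n × (Fin n → ℝ) => (x.1, fun j => circleMap 0 1 (x.2 j)))

end CoordinateRotation

namespace QuotientQuadruple

variable {n : ℕ} (Q : QuotientQuadruple n)

theorem isBounded_X : Bornology.IsBounded Q.X := by
  rcases Q.model with ⟨hX, -⟩ | ⟨-, hX, -⟩
  · rw [hX]
    refine ((EuclideanSpace.equiv (Fin n) ℂ).antilipschitz.isBounded_preimage
      (Metric.isBounded_ball (x := (0 : Fin n → ℂ)) (r := 1))).subset fun z hz => ?_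
    rw [mem_preimage, mem_ball_zero_iff, pi_norm_lt_iff one_pos]
    exact hz
  · exact hX

theorem mem_X_of_norm_le {z z' : Cn n} (hz : z ∈ Q.X) (h : ∀ j, ‖z' j‖ ≤ ‖z j‖) : z' ∈ Q.X := by
  rcases Q.model with ⟨hX, -⟩ | ⟨hX, -⟩
  · rw [hX] at hz ⊢
    exact fun j => (h j).trans_lt (hz j)
  · exact hX.2.2 z hz z' h

theorem isClosed_Γ : IsClosed Q.Γ := by
  rcases Q.model with ⟨-, hΓ, -⟩ | ⟨-, -, -, hΓ, -⟩
  · have hinter : Q.Γ = ⋂ j, {z : Cn n | ‖z j‖ = 1} := by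
      rw [hΓ, unitTorus, ofPred_forall]
    rw [hinter]
    exact isClosed_iInter fun j => isClosed_eq (by fun_prop) continuous_const
  · rw [hΓ]
    exact isClosed_frontier

theorem isCompact_Γ : IsCompact Q.Γ :=
  Q.isBounded_X.isCompact_closure.of_isClosed_subset Q.isClosed_Γ Q.Γ_subset_closure

theorem coordinateRotation_mem_Γ_iff (θ : Fin n → ℝ) (z : Cn n) :
    coordinateRotation θ z ∈ Q.Γ ↔ z ∈ Q.Γ := by
  rcases Q.model with ⟨-, hΓ, -⟩ | ⟨-, -, -, hΓ, -⟩
  · rw [hΓ]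
    exact forall_congr' fun j => by rw [norm_coordinateRotation_apply]
  · have hpre : (coordinateRotation θ).toHomeomorph ⁻¹' Q.X = Q.X := by
      ext y
      exact ⟨fun hy => Q.mem_X_of_norm_le (z := coordinateRotation θ y) hy fun j =>
          (norm_coordinateRotation_apply θ y j).ge,
        fun hy => Q.mem_X_of_norm_le hy fun j => (norm_coordinateRotation_apply θ y j).le⟩
    have hfrontier := (coordinateRotation θ).toHomeomorph.preimage_frontier Q.X
    rw [hpre, ← hΓ] at hfrontier
    exact Set.ext_iff.mp hfrontier z

theorem apply_mem_Γ_iff {τ : Cn n ≃ₗᵢ[ℂ] Cn n} (hτ : τ ∈ Q.G) (z : Cn n) :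
    τ z ∈ Q.Γ ↔ z ∈ Q.Γ := by
  refine ⟨fun h => ?_, fun h => Q.invariant_Γ τ hτ z h⟩
  have := Q.invariant_Γ τ⁻¹ (Q.G.inv_mem hτ) _ h
  rwa [show τ⁻¹ (τ z) = z from τ.symm_apply_apply z] at this

theorem measurePreserving_of_mem_Γ_iff (e : Cn n ≃ᵢ Cn n) (he : ∀ z, e z ∈ Q.Γ ↔ z ∈ Q.Γ) :
    MeasurePreserving e Q.σ Q.σ := by
  have h := (e.measurePreserving_euclideanHausdorffMeasure Q.d).restrict_preimage Q.measurableSet_Γ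
  rwa [show e ⁻¹' Q.Γ = Q.Γ from Set.ext he] at h

theorem measurePreserving_G {τ : Cn n ≃ₗᵢ[ℂ] Cn n} (hτ : τ ∈ Q.G) :
    MeasurePreserving τ Q.σ Q.σ :=
  Q.measurePreserving_of_mem_Γ_iff τ.toIsometryEquiv (Q.apply_mem_Γ_iff hτ)

theorem measurePreserving_coordinateRotation (θ : Fin n → ℝ) :
    MeasurePreserving (coordinateRotation θ) Q.σ Q.σ :=
  Q.measurePreserving_of_mem_Γ_iff (coordinateRotation θ).toIsometryEquiv
    (Q.coordinateRotation_mem_Γ_iff θ)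

theorem euclideanHausdorffMeasure_Γ_lt_top : μHE[Q.d] Q.Γ < ⊤ := by
  rcases Q.model with ⟨-, hΓ, hd⟩ | ⟨hX, hb, h2, hΓ, hd⟩
  · rw [hΓ, hd]
    exact euclideanHausdorffMeasure_unitTorus_lt_top n
  · rw [hΓ, hd]
    exact euclideanHausdorffMeasure_frontier_lt_top hX.1 hb h2

instance isFiniteMeasure_σ : IsFiniteMeasure Q.σ :=
  isFiniteMeasure_restrict.mpr Q.euclideanHausdorffMeasure_Γ_lt_top.ne

theorem continuousOn_Φ : ContinuousOn Q.Φ (closure Q.X) := fun _ hz =>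
  (Q.contDiffAt_Φ hz).continuousAt.continuousWithinAt

theorem exists_lipschitzOnWith_Φ {z : Cn n} (hz : z ∈ closure Q.X) :
    ∃ K : ℝ≥0, ∃ t ∈ 𝓝 z, LipschitzOnWith K Q.Φ t :=
  ((Q.contDiffAt_Φ hz).of_le (by simp)).exists_lipschitzOnWith

instance isFiniteMeasure_m : IsFiniteMeasure Q.m :=
  isFiniteMeasure_restrict.mpr
    (euclideanHausdorffMeasure_image_lt_top_of_isCompact Q.isCompact_Γ
      (fun _ hz => Q.exists_lipschitzOnWith_Φ (Q.Γ_subset_closure hz))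
      Q.euclideanHausdorffMeasure_Γ_lt_top).ne

theorem ae_mem_Γ : ∀ᵐ z ∂Q.σ, z ∈ Q.Γ := ae_restrict_mem Q.measurableSet_Γ

theorem ae_coord_ne_zero : ∀ᵐ z ∂Q.σ, ∀ j, z j ≠ 0 := by
  refine ae_all_iff.mpr fun j => ?_
  rcases Q.model with ⟨-, hΓ, -⟩ | ⟨-, -, -, -, hd⟩
  · filter_upwards [Q.ae_mem_Γ] with z hz h0
    rw [hΓ] at hz
    simpa [h0] using hz j
  · rw [ae_iff]
    simp only [not_not]
    refine Measure.absolutelyContinuous_of_le Measure.restrict_le_self ?_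
    rw [hd]
    exact euclideanHausdorffMeasure_coordinate_hyperplane j

theorem coordinateMul_mem_X {z : Cn n} (hz : z ∈ Q.Γ) {ζ : Fin n → ℂ}
    (hζ : ζ ∈ Metric.ball 0 1) : coordinateMul z ζ ∈ Q.X := by
  rw [mem_ball_zero_iff] at hζ
  have hc : max ‖ζ‖ (1 / 2) ∈ Ioo (0 : ℝ) 1 :=
    ⟨lt_max_of_lt_right (by norm_num), max_lt hζ (by norm_num)⟩
  refine Q.mem_X_of_norm_le (Q.smul_mem hz hc) fun j => ?_
  simp only [coordinateMul_apply, norm_mul, PiLp.smul_apply, smul_eq_mul, Complex.norm_real,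
    Real.norm_of_nonneg hc.1.le]
  gcongr
  exact (norm_le_pi_norm ζ j).trans (le_max_left _ _)

theorem coordinateMul_mem_closure_X {z : Cn n} (hz : z ∈ Q.Γ) {ζ : Fin n → ℂ}
    (hζ : ζ ∈ Metric.closedBall 0 1) : coordinateMul z ζ ∈ closure Q.X := by
  rw [← closure_ball (0 : Fin n → ℂ) one_ne_zero] at hζ
  exact MapsTo.closure (fun ζ hζ => Q.coordinateMul_mem_X hz hζ)
    (differentiable_coordinateMul z).continuous hζ

theorem volume_zeros_jac_torus_eq_zero {z : Cn n} (hz : z ∈ Q.Γ) (hz0 : ∀ j, z j ≠ 0) :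
    (Measure.pi fun _ : Fin n => volume.restrict (Ioc 0 (2 * Real.pi)))
      {θ : Fin n → ℝ | Q.jac (coordinateRotation θ z) = 0} = 0 := by
  by_contra hpos
  have hdiff := differentiable_coordinateMul z
  have hjac : ∀ ζ ∈ Metric.closedBall 0 1, Q.jac (coordinateMul z ζ) = 0 :=
    eq_zero_of_volume_zeros_torus_ne_zero
      (fun ζ hζ => ((Q.continuousAt_jac (Q.coordinateMul_mem_closure_X hz hζ)).comp
        hdiff.continuous.continuousAt).continuousWithinAt)
      (Q.differentiableOn_jac.comp hdiff.differentiableOn fun ζ hζ => Q.coordinateMul_mem_X hz hζ)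
      (by simpa only [coordinateRotation_eq] using hpos)
  have hopen : IsOpen {y : Cn n | ∀ j, ‖y j‖ < ‖z j‖} := by
    rw [ofPred_forall]
    exact isOpen_iInter_of_finite fun j => isOpen_lt (by fun_prop) continuous_const
  obtain ⟨y, hy, hJ⟩ := Q.exists_jac_ne_zero (V := {y : Cn n | ∀ j, ‖y j‖ < ‖z j‖})
    (fun y hy => by
      obtain ⟨ζ, hζ, rfl⟩ := exists_coordinateMul_eq hy
      exact Q.coordinateMul_mem_X hz hζ) hopen ⟨0, fun j => by simpa using hz0 j⟩
  obtain ⟨ζ, hζ, rfl⟩ := exists_coordinateMul_eq hy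
  exact hJ (hjac ζ (Metric.ball_subset_closedBall hζ))

theorem isClosed_zeros_jac : IsClosed (Q.Γ ∩ {z | Q.jac z = 0}) :=
  ContinuousOn.preimage_isClosed_of_isClosed (t := {0})
    (fun _ hz => (Q.continuousAt_jac (Q.Γ_subset_closure hz)).continuousWithinAt)
    Q.isClosed_Γ isClosed_singleton

theorem ae_jac_ne_zero : ∀ᵐ z ∂Q.σ, Q.jac z ≠ 0 := by
  have : NeZero (Measure.pi fun _ : Fin n => volume.restrict (Ioc 0 (2 * Real.pi))) :=
    ⟨Measure.measure_univ_ne_zero.mp (by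
      rw [Measure.pi_univ]
      simp [Real.pi_pos.not_ge])⟩
  have hnull : Q.σ (Q.Γ ∩ {z | Q.jac z = 0}) = 0 :=
    measure_eq_zero_of_ae_measure_orbit_eq_zero
      (ν := Measure.pi fun _ : Fin n => volume.restrict (Ioc 0 (2 * Real.pi)))
      continuous_coordinateRotation.measurable Q.measurePreserving_coordinateRotation
      Q.isClosed_zeros_jac.measurableSet (by
        filter_upwards [Q.ae_mem_Γ, Q.ae_coord_ne_zero] with z hz hz0
        exact measure_mono_null (fun θ hθ => hθ.2) (Q.volume_zeros_jac_torus_eq_zero hz hz0))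
  filter_upwards [Q.ae_mem_Γ, measure_eq_zero_iff_ae_notMem.mp hnull] with z hz hzJ h0
  exact hzJ ⟨hz, h0⟩

theorem exists_continuousLinearEquiv_hasStrictFDerivAt_Φ {z : Cn n} (hz : z ∈ closure Q.X)
    (hJ : Q.jac z ≠ 0) :
    ∃ e : Cn n ≃L[ℝ] Cn n, HasStrictFDerivAt Q.Φ (e : Cn n →L[ℝ] Cn n) z :=
  ⟨(LinearEquiv.ofInjectiveEndo (fderiv ℝ Q.Φ z : Cn n →ₗ[ℝ] Cn n)
      (injective_of_complexMatrix_det_ne_zero (Q.fderiv_Φ_smul hz) hJ)).toContinuousLinearEquiv,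
    (Q.contDiffAt_Φ hz).hasStrictFDerivAt (by simp)⟩

theorem euclideanHausdorffMeasure_eq_zero_of_image_Φ {K : Set (Cn n)} (hK : K ⊆ closure Q.X)
    (hJ : ∀ z ∈ K, Q.jac z ≠ 0) (h : μHE[Q.d] (Q.Φ '' K) = 0) : μHE[Q.d] K = 0 := by
  refine measure_null_of_locally_null K fun z hz => ?_
  obtain ⟨e, he⟩ := Q.exists_continuousLinearEquiv_hasStrictFDerivAt_Φ (hK hz) (hJ z hz)
  set Ψ := he.localInverse Q.Φ e z
  obtain ⟨C, t, ht, hC⟩ := he.to_localInverse.exists_lipschitzOnWith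
  refine ⟨K ∩ ({y | Ψ (Q.Φ y) = y} ∩ Q.Φ ⁻¹' t), inter_mem_nhdsWithin _
    (inter_mem he.eventually_left_inverse (he.hasFDerivAt.continuousAt ht)), ?_⟩
  have hsub : K ∩ ({y | Ψ (Q.Φ y) = y} ∩ Q.Φ ⁻¹' t) ⊆ Ψ '' (Q.Φ '' K ∩ t) := by
    rintro y ⟨hyK, hyΨ, hyt⟩
    exact ⟨Q.Φ y, ⟨⟨y, hyK, rfl⟩, hyt⟩, hyΨ⟩
  refine measure_mono_null hsub (nonpos_iff_eq_zero.mp ?_)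
  calc μHE[Q.d] (Ψ '' (Q.Φ '' K ∩ t))
      ≤ C ^ Q.d * μHE[Q.d] (Q.Φ '' K ∩ t) :=
        euclideanHausdorffMeasure_image_le_of_lipschitzOnWith (hC.mono inter_subset_right) Q.d
    _ = 0 := by rw [measure_mono_null inter_subset_left h, mul_zero]

/-- The restriction of `Φ` to `Γ`, extended by zero in order to be measurable. -/
noncomputable def boundaryMap : Cn n → Cn n := Q.Γ.indicator Q.Φ

theorem boundaryMap_eq {z : Cn n} (hz : z ∈ Q.Γ) : Q.boundaryMap z = Q.Φ z :=
  indicator_of_mem hz _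

theorem measurable_boundaryMap : Measurable Q.boundaryMap := by
  classical
  rw [boundaryMap, ← piecewise_eq_indicator]
  exact (Q.continuousOn_Φ.mono Q.Γ_subset_closure).measurable_piecewise continuousOn_const
    Q.measurableSet_Γ

/-- The pulled-back surface measure `|G|⁻¹ w dσ` on `Γ_X`. -/
noncomputable def pullbackMeasure (w : Cn n → ℝ) : Measure (Cn n) :=
  (Nat.card Q.G : ℝ≥0∞)⁻¹ • Q.σ.withDensity fun z => ENNReal.ofReal (w z)

theorem measurePreserving_boundaryMap {w : Cn n → ℝ} (hw : Q.IsPullbackDensity w) :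
    MeasurePreserving Q.boundaryMap (Q.pullbackMeasure w) Q.m := by
  refine ⟨Q.measurable_boundaryMap, Measure.ext fun S hS => ?_⟩
  have hpre := Q.measurable_boundaryMap hS
  have hset : Q.Γ ∩ Q.Φ ⁻¹' S = Q.boundaryMap ⁻¹' S ∩ Q.Γ := by
    rw [inter_comm (Q.boundaryMap ⁻¹' S)]
    ext z
    exact and_congr_right fun hz => by rw [mem_preimage, mem_preimage, Q.boundaryMap_eq hz]
  rw [Measure.map_apply Q.measurable_boundaryMap hS, pullbackMeasure, Measure.smul_apply,
    withDensity_apply _ hpre, ← hw.density S hS, σ, inducedMeasure, Measure.restrict_restrict hpre,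
    hset, smul_eq_mul]

theorem measurableSet_image_Φ {K : Set (Cn n)} (hK : IsCompact K) (hKΓ : K ⊆ Q.Γ) :
    MeasurableSet (Q.Φ '' K) :=
  (hK.image_of_continuousOn
    (Q.continuousOn_Φ.mono (hKΓ.trans Q.Γ_subset_closure))).measurableSet

theorem exists_isCompact_forall_ae_boundaryMap_mem_image {E : Set (Cn n)}
    (hE : NullMeasurableSet E Q.σ) (hinv : ∀ τ ∈ Q.G, ∀ᵐ z ∂Q.σ, τ z ∈ E → z ∈ E)
    (hpos : Q.σ E ≠ 0) :
    ∃ K ⊆ E, K ⊆ Q.Γ ∧ IsCompact K ∧ Q.σ K ≠ 0 ∧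
      ∀ᵐ z ∂Q.σ, Q.boundaryMap z ∈ Q.Φ '' K → z ∈ E := by
  have := Q.finite_G
  obtain ⟨E', hE'E, hE', hae⟩ :=
    (hE.inter Q.measurableSet_Γ.nullMeasurableSet).exists_measurable_subset_ae_eq
  have hEΓ : (E ∩ Q.Γ : Set (Cn n)) =ᵐ[Q.σ] E :=
    inter_ae_eq_left_of_ae_eq_univ (eventuallyEq_univ.mpr Q.ae_mem_Γ)
  obtain ⟨K, hKE', hK, hKpos⟩ := hE'.exists_lt_isCompact (μ := Q.σ) (r := 0)
    (pos_iff_ne_zero.mpr (by rwa [measure_congr (hae.trans hEΓ)]))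
  have hKE := hKE'.trans hE'E
  refine ⟨K, fun z hz => (hKE hz).1, fun z hz => (hKE hz).2, hK, hKpos.ne', ?_⟩
  have hinv' : ∀ᵐ z ∂Q.σ, ∀ τ : Q.G, τ.1 z ∈ E → z ∈ E :=
    ae_all_iff.mpr fun τ => hinv τ.1 τ.2
  filter_upwards [hinv', Q.ae_mem_Γ, show ∀ᵐ z ∂Q.σ, _ from Q.fibre_Γ] with z hz hzΓ hfibre hzK
  rw [Q.boundaryMap_eq hzΓ] at hzK
  obtain ⟨y, hy, hyz⟩ := hzK
  obtain ⟨τ, hτ, rfl⟩ := hfibre y (hKE hy).2 hyz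
  exact hz ⟨τ, hτ⟩ (hKE hy).1

/-- Where `w = 0` and the Jacobian does not vanish, `Φ` would map a set of positive measure onto
a null set, although it is locally bi-Lipschitz there. -/
theorem ae_density_pos {w : Cn n → ℝ} (hw : Q.IsPullbackDensity w) : ∀ᵐ z ∂Q.σ, 0 < w z := by
  set E : Set (Cn n) := {z | Q.jac z ≠ 0 ∧ w z = 0}
  have hEae : {z | w z = 0} =ᵐ[Q.σ] E := by
    filter_upwards [Q.ae_jac_ne_zero] with z hz
    exact propext (and_iff_right hz).symm
  suffices hnull : Q.σ E = 0 by
    filter_upwards [measure_eq_zero_iff_ae_notMem.mp hnull, Q.ae_jac_ne_zero] with z hz hJ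
    exact (hw.nonneg z).lt_of_ne' fun h0 => hz ⟨hJ, h0⟩
  by_contra hpos
  obtain ⟨K, hKE, hKΓ, hK, hKpos, hae⟩ := Q.exists_isCompact_forall_ae_boundaryMap_mem_image
    ((hw.measurable (measurableSet_singleton 0)).nullMeasurableSet.congr hEae)
    (fun τ hτ => by
      filter_upwards [Q.ae_jac_ne_zero, hw.invariant τ hτ] with z hJ hwz hz
      exact ⟨hJ, hwz.symm.trans hz.2⟩) hpos
  have hS := Q.measurableSet_image_Φ hK hKΓ
  have hm : Q.m (Q.Φ '' K) = 0 := by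
    have hpre := Q.measurable_boundaryMap hS
    rw [← (Q.measurePreserving_boundaryMap hw).measure_preimage hS.nullMeasurableSet,
      pullbackMeasure, Measure.smul_apply, withDensity_apply _ hpre, smul_eq_mul]
    refine mul_eq_zero_of_right _ ((setLIntegral_eq_zero_iff' hpre
      hw.measurable.ennreal_ofReal.aemeasurable).mpr ?_)
    filter_upwards [hae] with z hz hzK
    rw [(hz hzK).2, ENNReal.ofReal_zero]
  rw [m, inducedMeasure, Measure.restrict_apply hS,
    inter_eq_left.mpr (show Q.Φ '' K ⊆ Q.ΓΩ from image_mono hKΓ)] at hm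
  exact hKpos (Measure.absolutelyContinuous_of_le Measure.restrict_le_self
    (Q.euclideanHausdorffMeasure_eq_zero_of_image_Φ (hKΓ.trans Q.Γ_subset_closure)
      (fun z hz => (hKE hz).1) hm))

end QuotientQuadruple

namespace QuotientQuadruple

section

variable {n : ℕ} (Q : QuotientQuadruple n)

theorem eventually_smul_mem_X {z : Cn n} (hz : z ∈ Q.Γ) :
    ∀ᶠ r : ℝ in 𝓝[<] 1, (r : ℂ) • z ∈ Q.X := by
  filter_upwards [Ioo_mem_nhdsLT one_pos] with r hr using Q.smul_mem hz hr

theorem tendsto_Φ_smul {z : Cn n} (hz : z ∈ Q.Γ) :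
    Tendsto (fun r : ℝ => Q.Φ ((r : ℂ) • z)) (𝓝[<] 1) (𝓝 (Q.Φ z)) := by
  have hsmul : Tendsto (fun r : ℝ => (r : ℂ) • z) (𝓝[<] 1) (𝓝 z) := by
    have : Continuous fun r : ℝ => (r : ℂ) • z := by fun_prop
    simpa using (this.tendsto 1).mono_left nhdsWithin_le_nhds
  exact (Q.contDiffAt_Φ (Q.Γ_subset_closure hz)).continuousAt.tendsto.comp hsmul

theorem Φ_apply_of_mem_Γ {τ : Cn n ≃ₗᵢ[ℂ] Cn n} (hτ : τ ∈ Q.G) {z : Cn n} (hz : z ∈ Q.Γ) :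
    Q.Φ (τ z) = Q.Φ z := by
  refine tendsto_nhds_unique (Q.tendsto_Φ_smul (Q.invariant_Γ τ hτ z hz))
    ((Q.tendsto_Φ_smul hz).congr' ?_)
  filter_upwards [Q.eventually_smul_mem_X hz] with r hr
  rw [← map_smul, Q.Φ_apply hτ hr]

theorem boundaryMap_apply {τ : Cn n ≃ₗᵢ[ℂ] Cn n} (hτ : τ ∈ Q.G) {z : Cn n} (hz : z ∈ Q.Γ) :
    Q.boundaryMap (τ z) = Q.boundaryMap z := by
  rw [Q.boundaryMap_eq hz, Q.boundaryMap_eq (Q.invariant_Γ τ hτ z hz), Q.Φ_apply_of_mem_Γ hτ hz]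

/-- `gs` is a measurable boundary function of the function `g` which witnesses admissibility of the
density `w`. -/
structure IsBoundaryDatum (w : Cn n → ℝ) (g gs : Cn n → ℂ) : Prop where
  density : Q.IsPullbackDensity w
  admissible : Q.IsAdmissible w g
  measurable : Measurable gs
  boundary : ∀ᵐ z ∂Q.σ, HasBoundaryValue g z (gs z)
  norm_sq : ∀ᵐ z ∂Q.σ, ‖gs z‖ ^ 2 = w z
  pos : ∀ᵐ z ∂Q.σ, 0 < w z

theorem aemeasurable_of_hasBoundaryValue {F φ : Cn n → ℂ} (hF : ContinuousOn F Q.X)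
    (h : ∀ᵐ z ∂Q.σ, HasBoundaryValue F z (φ z)) : AEMeasurable φ Q.σ := by
  obtain ⟨r, -, hr, hr1⟩ := exists_seq_strictMono_tendsto' (one_pos : (0 : ℝ) < 1)
  have hr1' : Tendsto r atTop (𝓝[<] 1) :=
    tendsto_nhdsWithin_iff.mpr ⟨hr1, Eventually.of_forall fun k => (hr k).2⟩
  exact aemeasurable_of_tendsto_metrizable_ae atTop
    (fun k => Q.aemeasurable_dilate hF (hr k)) (h.mono fun z hz => hz.comp hr1')

theorem exists_isBoundaryDatum {w : Cn n → ℝ} (hw : Q.IsPullbackDensity w)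
    {g : Cn n → ℂ} (hg : Q.IsAdmissible w g) : ∃ gs, Q.IsBoundaryDatum w g gs := by
  obtain ⟨l, hl⟩ : ∃ l : Cn n → ℂ, ∀ᵐ z ∂Q.σ, HasBoundaryValue g z (l z) ∧ ‖l z‖ ^ 2 = w z := by
    classical
    refine ⟨fun z => if h : ∃ l : ℂ, HasBoundaryValue g z l ∧ ‖l‖ ^ 2 = w z
      then h.choose else 0, ?_⟩
    filter_upwards [hg.boundary] with z hz
    rw [dif_pos hz]
    exact hz.choose_spec
  have hlm := Q.aemeasurable_of_hasBoundaryValue hg.holomorphic.continuousOn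
    (hl.mono fun z hz => hz.1)
  have hmk : ∀ᵐ z ∂Q.σ, HasBoundaryValue g z (hlm.mk l z) ∧ ‖hlm.mk l z‖ ^ 2 = w z := by
    filter_upwards [hl, hlm.ae_eq_mk] with z hz hz'
    rwa [← hz']
  exact ⟨hlm.mk l, hw, hg, hlm.measurable_mk, hmk.mono fun z hz => hz.1,
    hmk.mono fun z hz => hz.2, Q.ae_density_pos hw⟩

theorem weightedMeasure_two (w : Cn n → ℝ) : Q.weightedMeasure w 2 = Q.σ := by
  simp [weightedMeasure]

theorem weightedMeasure_absolutelyContinuous (w : Cn n → ℝ) (p : ℝ) :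
    Q.weightedMeasure w p ≪ Q.σ := withDensity_absolutelyContinuous _ _

/-- The constant `|G|^{-1/2}`, for which `lift` preserves the `L²`-norm. -/
noncomputable def normConst : ℂ := ((√(Nat.card Q.G : ℝ))⁻¹ : ℝ)

theorem normConst_ne_zero : Q.normConst ≠ 0 := by
  have : 0 < √(Nat.card Q.G : ℝ) := Real.sqrt_pos.mpr (Nat.cast_pos.mpr Q.card_pos)
  simpa [normConst] using this.ne'

theorem enorm_normConst_rpow_two : ‖Q.normConst‖ₑ ^ (2 : ℝ) = (Nat.card Q.G : ℝ≥0∞)⁻¹ := by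
  have h0 : (0 : ℝ) < Nat.card Q.G := Nat.cast_pos.mpr Q.card_pos
  rw [← ofReal_norm, normConst, Complex.norm_real, Real.norm_of_nonneg (by positivity),
    ENNReal.ofReal_rpow_of_nonneg (by positivity) (by norm_num), Real.rpow_two, inv_pow,
    Real.sq_sqrt h0.le, ENNReal.ofReal_inv_of_pos h0, ENNReal.ofReal_natCast]

theorem enorm_normConst_rpow_ne_zero {p : ℝ} (hp : 0 ≤ p) : ‖Q.normConst‖ₑ ^ p ≠ 0 :=
  (ENNReal.rpow_pos_of_nonneg (enorm_pos.mpr Q.normConst_ne_zero) hp).ne'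

/-- The function `|G|^{-1/2} (φ ∘ Φ) g*` on `Γ_X` which corresponds to the function `φ`
on `Γ_Ω`. -/
noncomputable def lift (gs φ : Cn n → ℂ) (z : Cn n) : ℂ :=
  Q.normConst * (φ (Q.boundaryMap z) * gs z)

/-- The factor `|G|^{1/p - 1/2}` by which `lift` multiplies `Lᵖ`-norms. -/
noncomputable def normRatio (p : ℝ) : ℝ≥0∞ := (‖Q.normConst‖ₑ ^ p * Nat.card Q.G) ^ (1 / p)

theorem normRatio_ne_top {p : ℝ} (hp : 0 < p) : Q.normRatio p ≠ ⊤ :=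
  ENNReal.rpow_ne_top_of_nonneg (by positivity) (ENNReal.mul_ne_top
    (ENNReal.rpow_ne_top_of_nonneg hp.le enorm_ne_top) (ENNReal.natCast_ne_top _))

theorem normRatio_ne_zero {p : ℝ} (hp : 0 < p) : Q.normRatio p ≠ 0 :=
  (ENNReal.rpow_pos_of_nonneg (pos_iff_ne_zero.mpr (mul_ne_zero
    (Q.enorm_normConst_rpow_ne_zero hp.le) (Nat.cast_ne_zero.mpr Q.card_pos.ne')))
    (by positivity)).ne'

theorem normRatio_two : Q.normRatio 2 = 1 := by
  rw [normRatio, Q.enorm_normConst_rpow_two, ENNReal.inv_mul_cancel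
      (Nat.cast_ne_zero.mpr Q.card_pos.ne') (ENNReal.natCast_ne_top _), ENNReal.one_rpow]

end

namespace IsBoundaryDatum

variable {n : ℕ} {Q : QuotientQuadruple n} {w : Cn n → ℝ} {g gs : Cn n → ℂ}

theorem ae_ne_zero (h : Q.IsBoundaryDatum w g gs) : ∀ᵐ z ∂Q.σ, gs z ≠ 0 := by
  filter_upwards [h.norm_sq, h.pos] with z hsq hpos hz
  simp [hz, hpos.ne] at hsq

theorem ae_apply_eq (h : Q.IsBoundaryDatum w g gs) {τ : Cn n ≃ₗᵢ[ℂ] Cn n} (hτ : τ ∈ Q.G) :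
    ∀ᵐ z ∂Q.σ, gs (τ z) = gs z := by
  filter_upwards [h.boundary, (Q.measurePreserving_G hτ).quasiMeasurePreserving.ae h.boundary,
    Q.ae_mem_Γ] with z hgz hgτz hz
  refine tendsto_nhds_unique hgτz (Tendsto.congr' ?_ hgz)
  filter_upwards [Q.eventually_smul_mem_X hz] with r hr
  rw [← map_smul, h.admissible.invariant τ hτ _ hr]

theorem absolutelyContinuous_pullbackMeasure (h : Q.IsBoundaryDatum w g gs) :
    Q.σ ≪ Q.pullbackMeasure w := by
  refine (withDensity_absolutelyContinuous' h.density.measurable.ennreal_ofReal.aemeasurable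
    ?_).smul_right Q.card_inv_ne_zero
  filter_upwards [h.pos] with z hz
  simpa using hz

theorem quasiMeasurePreserving_boundaryMap (h : Q.IsBoundaryDatum w g gs) :
    Measure.QuasiMeasurePreserving Q.boundaryMap Q.σ Q.m :=
  (Q.measurePreserving_boundaryMap h.density).quasiMeasurePreserving.mono_left
    h.absolutelyContinuous_pullbackMeasure

theorem card_mul_lintegral_m (h : Q.IsBoundaryDatum w g gs) {k : Cn n → ℝ≥0∞}
    (hk : AEMeasurable k Q.m) :
    (Nat.card Q.G : ℝ≥0∞) * ∫⁻ y, k y ∂Q.m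
      = ∫⁻ z, ENNReal.ofReal (w z) * k (Q.boundaryMap z) ∂Q.σ := by
  have hmp := Q.measurePreserving_boundaryMap h.density
  have hm : ∫⁻ y, k y ∂Q.m = ∫⁻ z, k (Q.boundaryMap z) ∂Q.pullbackMeasure w := by
    rw [← hmp.map_eq] at hk
    rw [← hmp.map_eq, lintegral_map' hk hmp.measurable.aemeasurable]
  rw [hm, pullbackMeasure, lintegral_smul_measure, smul_eq_mul, ← mul_assoc,
    ENNReal.mul_inv_cancel (Nat.cast_ne_zero.mpr Q.card_pos.ne') (ENNReal.natCast_ne_top _),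
    one_mul]
  exact lintegral_withDensity_eq_lintegral_mul₀ h.density.measurable.ennreal_ofReal.aemeasurable
    (hk.comp_quasiMeasurePreserving h.quasiMeasurePreserving_boundaryMap)

theorem lift_congr (h : Q.IsBoundaryDatum w g gs) {φ ψ : Cn n → ℂ} (hφ : φ =ᵐ[Q.m] ψ) :
    Q.lift gs φ =ᵐ[Q.σ] Q.lift gs ψ := by
  filter_upwards [h.quasiMeasurePreserving_boundaryMap.ae hφ] with z hz
  rw [lift, hz, lift]

theorem isInvariantΓ_lift (h : Q.IsBoundaryDatum w g gs) (φ : Cn n → ℂ) :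
    Q.IsInvariantΓ (Q.lift gs φ) := by
  intro τ hτ
  filter_upwards [h.ae_apply_eq hτ, Q.ae_mem_Γ] with z hgs hz
  rw [lift, hgs, Q.boundaryMap_apply hτ hz, lift]

theorem aestronglyMeasurable_lift (h : Q.IsBoundaryDatum w g gs) {φ : Cn n → ℂ}
    (hφ : AEStronglyMeasurable φ Q.m) : AEStronglyMeasurable (Q.lift gs φ) Q.σ :=
  ((hφ.comp_quasiMeasurePreserving h.quasiMeasurePreserving_boundaryMap).mul
    h.measurable.aestronglyMeasurable).const_mul _

theorem ae_weight_mul_enorm_rpow (h : Q.IsBoundaryDatum w g gs) (p : ℝ) :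
    ∀ᵐ z ∂Q.σ, ENNReal.ofReal (w z) ^ (1 - p / 2) * ‖gs z‖ₑ ^ p = ENNReal.ofReal (w z) := by
  filter_upwards [h.norm_sq, h.pos] with z hsq hpos
  have hgs : ‖gs z‖ₑ ^ p = ENNReal.ofReal (w z) ^ (p / 2) := by
    rw [← hsq, ← Real.rpow_two, ← ENNReal.ofReal_rpow_of_nonneg (norm_nonneg _) (by norm_num),
      ofReal_norm, ← ENNReal.rpow_mul, mul_div_cancel₀ p two_ne_zero]
  rw [hgs, ← ENNReal.rpow_add _ _ (ENNReal.ofReal_pos.mpr hpos).ne' ENNReal.ofReal_ne_top,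
    sub_add_cancel, ENNReal.rpow_one]

theorem lintegral_lift (h : Q.IsBoundaryDatum w g gs) {p : ℝ} (hp : 0 ≤ p) {φ : Cn n → ℂ}
    (hφ : AEStronglyMeasurable φ Q.m) :
    ∫⁻ z, ‖Q.lift gs φ z‖ₑ ^ p ∂Q.weightedMeasure w p
      = ‖Q.normConst‖ₑ ^ p * Nat.card Q.G * ∫⁻ y, ‖φ y‖ₑ ^ p ∂Q.m := by
  rw [mul_assoc, h.card_mul_lintegral_m (hφ.enorm.pow_const p), ← lintegral_const_mul'
    _ _ (ENNReal.rpow_ne_top_of_nonneg hp enorm_ne_top), weightedMeasure,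
    lintegral_withDensity_eq_lintegral_mul₀
      (h.density.measurable.ennreal_ofReal.pow_const _).aemeasurable
      ((h.aestronglyMeasurable_lift hφ).enorm.pow_const p)]
  refine lintegral_congr_ae ?_
  filter_upwards [h.ae_weight_mul_enorm_rpow p] with z hz
  rw [Pi.mul_apply, lift, enorm_mul, enorm_mul, ENNReal.mul_rpow_of_nonneg _ _ hp,
    ENNReal.mul_rpow_of_nonneg _ _ hp]
  conv_rhs => rw [← hz]
  ring

theorem eLpNorm_lift (h : Q.IsBoundaryDatum w g gs) {p : ℝ} (hp : 0 < p) {φ : Cn n → ℂ}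
    (hφ : AEStronglyMeasurable φ Q.m) :
    eLpNorm (Q.lift gs φ) (ENNReal.ofReal p) (Q.weightedMeasure w p)
      = Q.normRatio p * eLpNorm φ (ENNReal.ofReal p) Q.m := by
  have h0 : ENNReal.ofReal p ≠ 0 := by simpa using hp
  rw [eLpNorm_eq_lintegral_rpow_enorm_toReal h0 ENNReal.ofReal_ne_top,
    eLpNorm_eq_lintegral_rpow_enorm_toReal h0 ENNReal.ofReal_ne_top, ENNReal.toReal_ofReal hp.le,
    h.lintegral_lift hp.le hφ, ENNReal.mul_rpow_of_nonneg _ _ (by positivity), normRatio]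

theorem eLpNorm_two_lift (h : Q.IsBoundaryDatum w g gs) {φ : Cn n → ℂ}
    (hφ : AEStronglyMeasurable φ Q.m) : eLpNorm (Q.lift gs φ) 2 Q.σ = eLpNorm φ 2 Q.m := by
  simpa only [Q.weightedMeasure_two, Q.normRatio_two, one_mul, ENNReal.ofReal_ofNat]
    using h.eLpNorm_lift two_pos hφ

theorem memLp_lift (h : Q.IsBoundaryDatum w g gs) {φ : Cn n → ℂ} (hφ : MemLp φ 2 Q.m) :
    MemLp (Q.lift gs φ) 2 Q.σ :=
  ⟨h.aestronglyMeasurable_lift hφ.1, by rw [h.eLpNorm_two_lift hφ.1]; exact hφ.2⟩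

/-- The isometry of `L²(Γ_Ω)` into `L²(Γ_X)` given by `lift`. -/
noncomputable def liftL (h : Q.IsBoundaryDatum w g gs) : Lp ℂ 2 Q.m →ₗᵢ[ℂ] Lp ℂ 2 Q.σ where
  toFun φ := (h.memLp_lift (Lp.memLp φ)).toLp
  map_add' φ ψ := by
    rw [← MemLp.toLp_add]
    refine MemLp.toLp_congr _ _ ((h.lift_congr (Lp.coeFn_add φ ψ)).trans (.of_forall fun z => ?_))
    simp only [lift, Pi.add_apply]
    ring
  map_smul' c φ := by
    rw [RingHom.id_apply, ← MemLp.toLp_const_smul]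
    refine MemLp.toLp_congr _ _ ((h.lift_congr (Lp.coeFn_smul c φ)).trans (.of_forall fun z => ?_))
    simp only [lift, Pi.smul_apply, smul_eq_mul]
    ring
  norm_map' φ := by
    simp only [LinearMap.coe_mk, AddHom.coe_mk]
    rw [Lp.norm_toLp, h.eLpNorm_two_lift (Lp.aestronglyMeasurable φ), Lp.norm_def]

theorem coeFn_liftL (h : Q.IsBoundaryDatum w g gs) (φ : Lp ℂ 2 Q.m) :
    h.liftL φ =ᵐ[Q.σ] Q.lift gs φ := (h.memLp_lift (Lp.memLp φ)).coeFn_toLp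

theorem eLpNorm_liftL (h : Q.IsBoundaryDatum w g gs) {p : ℝ} (hp : 0 < p) (φ : Lp ℂ 2 Q.m) :
    eLpNorm (h.liftL φ) (ENNReal.ofReal p) (Q.weightedMeasure w p)
      = Q.normRatio p * eLpNorm φ (ENNReal.ofReal p) Q.m := by
  rw [eLpNorm_congr_ae ((Q.weightedMeasure_absolutelyContinuous w p).ae_eq (h.coeFn_liftL φ)),
    h.eLpNorm_lift hp (Lp.aestronglyMeasurable φ)]

theorem memLp_liftL_iff (h : Q.IsBoundaryDatum w g gs) {p : ℝ} (hp : 0 < p) (φ : Lp ℂ 2 Q.m) :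
    MemLp (h.liftL φ) (ENNReal.ofReal p) (Q.weightedMeasure w p)
      ↔ MemLp φ (ENNReal.ofReal p) Q.m := by
  have hmeas : AEStronglyMeasurable (h.liftL φ) (Q.weightedMeasure w p) :=
    (Lp.aestronglyMeasurable (h.liftL φ)).mono_ac (Q.weightedMeasure_absolutelyContinuous w p)
  rw [MemLp, MemLp, h.eLpNorm_liftL hp, and_iff_right hmeas,
    and_iff_right (Lp.aestronglyMeasurable φ)]
  exact ⟨fun hφ => ENNReal.lt_top_of_mul_ne_top_right hφ.ne (Q.normRatio_ne_zero hp),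
    fun hφ => ENNReal.mul_lt_top (Q.normRatio_ne_top hp).lt_top hφ⟩

theorem isInvariantΓ_liftL (h : Q.IsBoundaryDatum w g gs) (φ : Lp ℂ 2 Q.m) :
    Q.IsInvariantΓ (h.liftL φ) := by
  intro τ hτ
  filter_upwards [h.coeFn_liftL φ, h.isInvariantΓ_lift φ τ hτ,
    (Q.measurePreserving_G hτ).quasiMeasurePreserving.ae (h.coeFn_liftL φ)] with z hz hinv hτz
  rw [hz, hτz, hinv]

end IsBoundaryDatum

end QuotientQuadruple

namespace QuotientQuadruple

section

variable {n : ℕ} (Q : QuotientQuadruple n)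

theorem ae_le_zero_of_setIntegral_preimage_eq_zero {u : Cn n → ℝ} (hu : Integrable u Q.σ)
    (hinv : ∀ τ ∈ Q.G, ∀ᵐ z ∂Q.σ, u (τ z) = u z)
    (h0 : ∀ S, MeasurableSet S → ∫ z in Q.boundaryMap ⁻¹' S, u z ∂Q.σ = 0) :
    ∀ᵐ z ∂Q.σ, u z ≤ 0 := by
  suffices hnull : Q.σ {z | 0 < u z} = 0 by
    filter_upwards [measure_eq_zero_iff_ae_notMem.mp hnull] with z hz using not_lt.mp hz
  by_contra hpos
  obtain ⟨K, -, hKΓ, hK, hKpos, hae⟩ := Q.exists_isCompact_forall_ae_boundaryMap_mem_image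
    (nullMeasurableSet_lt aemeasurable_const hu.aemeasurable)
    (fun τ hτ => (hinv τ hτ).mono fun z hz h => h.trans_eq hz) hpos
  have hS := Q.measurableSet_image_Φ hK hKΓ
  have hupos : ∀ᵐ z ∂Q.σ.restrict (Q.boundaryMap ⁻¹' (Q.Φ '' K)), 0 < u z :=
    (ae_restrict_iff' (Q.measurable_boundaryMap hS)).mpr hae
  have huzero := (integral_eq_zero_iff_of_nonneg_ae (hupos.mono fun z hz => hz.le)
    hu.integrableOn).mp (h0 _ hS)
  have hnull : Q.σ (Q.boundaryMap ⁻¹' (Q.Φ '' K)) = 0 := by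
    rw [← Measure.restrict_eq_zero, ← ae_eq_bot]
    refine Filter.eventually_false_iff_eq_bot.mp ?_
    filter_upwards [hupos, huzero] with z hz hz' using hz.ne' hz'
  refine hKpos (measure_mono_null (fun z hz => ?_) hnull)
  rw [mem_preimage, Q.boundaryMap_eq (hKΓ hz)]
  exact mem_image_of_mem _ hz

theorem ae_eq_zero_of_setIntegral_preimage_eq_zero {u : Cn n → ℂ} (hu : Integrable u Q.σ)
    (hinv : Q.IsInvariantΓ u)
    (h0 : ∀ S, MeasurableSet S → ∫ z in Q.boundaryMap ⁻¹' S, u z ∂Q.σ = 0) :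
    ∀ᵐ z ∂Q.σ, u z = 0 := by
  have key : ∀ L : ℂ →L[ℝ] ℝ, ∀ᵐ z ∂Q.σ, L (u z) ≤ 0 := fun L =>
    Q.ae_le_zero_of_setIntegral_preimage_eq_zero (L.integrable_comp hu)
      (fun τ hτ => (hinv τ hτ).mono fun z hz => by simp only [hz]) fun S hS => by
        rw [L.integral_comp_comm hu.integrableOn, h0 S hS, map_zero]
  filter_upwards [key Complex.reCLM, key (-Complex.reCLM), key Complex.imCLM,
    key (-Complex.imCLM)] with z hre hre' him him'
  simp only [Complex.reCLM_apply, Complex.imCLM_apply, _root_.neg_apply, neg_nonpos]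
    at hre hre' him him'
  exact Complex.ext (le_antisymm hre hre') (le_antisymm him him')

theorem isInvariantΓ_sub {φ ψ : Lp ℂ 2 Q.σ} (hφ : Q.IsInvariantΓ φ) (hψ : Q.IsInvariantΓ ψ) :
    Q.IsInvariantΓ (φ - ψ : Lp ℂ 2 Q.σ) := by
  intro τ hτ
  filter_upwards [hφ τ hτ, hψ τ hτ, Lp.coeFn_sub φ ψ,
    (Q.measurePreserving_G hτ).quasiMeasurePreserving.ae (Lp.coeFn_sub φ ψ)]
    with z hφz hψz hz hτz
  rw [hz, hτz, Pi.sub_apply, Pi.sub_apply, hφz, hψz]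

end

namespace IsBoundaryDatum

variable {n : ℕ} {Q : QuotientQuadruple n} {w : Cn n → ℝ} {g gs : Cn n → ℂ}

theorem memLp_two (h : Q.IsBoundaryDatum w g gs) : MemLp gs 2 Q.σ := by
  refine ((h.memLp_lift (memLp_const 1)).const_mul Q.normConst⁻¹).ae_eq (.of_forall fun z => ?_)
  rw [lift, one_mul, inv_mul_cancel_left₀ Q.normConst_ne_zero]

theorem inner_liftL_indicatorConstLp (h : Q.IsBoundaryDatum w g gs) {S : Set (Cn n)}
    (hS : MeasurableSet S) (ψ : Lp ℂ 2 Q.σ) :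
    inner ℂ (h.liftL (indicatorConstLp 2 hS (measure_ne_top Q.m S) (1 : ℂ))) ψ
      = star Q.normConst * ∫ z in Q.boundaryMap ⁻¹' S, inner ℂ (gs z) (ψ z) ∂Q.σ := by
  rw [L2.inner_def, ← integral_indicator (Q.measurable_boundaryMap hS), ← integral_const_mul]
  refine integral_congr_ae ?_
  filter_upwards [h.coeFn_liftL (indicatorConstLp 2 hS (measure_ne_top Q.m S) (1 : ℂ)),
    h.quasiMeasurePreserving_boundaryMap.ae (indicatorConstLp_coeFn (p := 2)
      (hs := hS) (hμs := measure_ne_top Q.m S) (c := (1 : ℂ)))] with z hz hind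
  rw [hz, lift, hind]
  by_cases hzS : Q.boundaryMap z ∈ S
  · simp only [hzS, indicator_of_mem, one_mul, RCLike.inner_apply, map_mul, RCLike.star_def,
      mem_preimage]
    ring
  · simp [hzS]

theorem eq_zero_of_inner_liftL_eq_zero (h : Q.IsBoundaryDatum w g gs) {ψ : Lp ℂ 2 Q.σ}
    (hψ : Q.IsInvariantΓ ψ) (h0 : ∀ φ, inner ℂ (h.liftL φ) ψ = 0) : ψ = 0 := by
  have hint : Integrable (fun z => inner ℂ (gs z) (ψ z)) Q.σ :=
    (L2.integrable_inner (h.memLp_two.toLp gs) ψ).congr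
      (h.memLp_two.coeFn_toLp.mono fun z hz => by simp only [hz])
  have hinv : Q.IsInvariantΓ fun z => inner ℂ (gs z) (ψ z) := fun τ hτ => by
    filter_upwards [hψ τ hτ, h.ae_apply_eq hτ] with z hψz hgsz
    rw [hψz, hgsz]
  have hzero : ∀ᵐ z ∂Q.σ, inner ℂ (gs z) (ψ z) = 0 :=
    Q.ae_eq_zero_of_setIntegral_preimage_eq_zero hint hinv fun S hS =>
      (mul_eq_zero.mp ((h.inner_liftL_indicatorConstLp hS ψ).symm.trans (h0 _))).resolve_left
        (star_ne_zero.mpr Q.normConst_ne_zero)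
  refine Lp.eq_zero_iff_ae_eq_zero.mpr ?_
  filter_upwards [hzero, h.ae_ne_zero] with z hz hgs
  simpa [hgs] using hz

theorem exists_liftL_eq (h : Q.IsBoundaryDatum w g gs) {ψ : Lp ℂ 2 Q.σ}
    (hψ : Q.IsInvariantΓ ψ) : ∃ φ, h.liftL φ = ψ := by
  set R := LinearMap.range h.liftL.toLinearMap
  have : CompleteSpace R := h.liftL.isometry.isUniformInducing.isComplete_range.completeSpace_coe
  obtain ⟨φ, hφ⟩ : R.starProjection ψ ∈ R := R.starProjection_apply_mem ψ
  have horth : ψ - h.liftL φ ∈ Rᗮ := by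
    rw [show h.liftL φ = R.starProjection ψ from hφ]
    exact R.sub_starProjection_mem_orthogonal ψ
  exact ⟨φ, (sub_eq_zero.mp (h.eq_zero_of_inner_liftL_eq_zero
    (Q.isInvariantΓ_sub hψ (h.isInvariantΓ_liftL φ)) fun χ => horth _ ⟨χ, rfl⟩)).symm⟩

end IsBoundaryDatum

end QuotientQuadruple

namespace QuotientQuadruple

section

variable {n : ℕ} (Q : QuotientQuadruple n)

noncomputable instance fintypeG : Fintype Q.G :=
  have := Q.finite_G
  Fintype.ofFinite _

theorem card_inv_mul_sum_const (c : ℂ) : (Nat.card Q.G : ℂ)⁻¹ * ∑ _τ : Q.G, c = c := by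
  rw [Finset.sum_const, Finset.card_univ, ← Nat.card_eq_fintype_card, nsmul_eq_mul,
    inv_mul_cancel_left₀ (Nat.cast_ne_zero.mpr Q.card_pos.ne')]

/-- The average of `F` over the group `G`. -/
noncomputable def average (F : Cn n → ℂ) (z : Cn n) : ℂ :=
  (Nat.card Q.G : ℂ)⁻¹ * ∑ τ : Q.G, F (τ.1 z)

theorem average_apply (F : Cn n → ℂ) {τ : Cn n ≃ₗᵢ[ℂ] Cn n} (hτ : τ ∈ Q.G) (z : Cn n) :
    Q.average F (τ z) = Q.average F z := by
  rw [average, average]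
  congr 1
  exact Fintype.sum_equiv (Equiv.mulRight ⟨τ, hτ⟩) _ _ fun _ => rfl

theorem exists_norm_average_le (F : Cn n → ℂ) (z : Cn n) :
    ∃ τ : Q.G, ‖Q.average F z‖ ≤ ‖F (τ.1 z)‖ := by
  obtain ⟨τ, -, hτ⟩ := Finset.exists_max_image Finset.univ (fun τ : Q.G => ‖F (τ.1 z)‖)
    Finset.univ_nonempty
  refine ⟨τ, ?_⟩
  rw [average, norm_mul, norm_inv, Complex.norm_natCast,
    inv_mul_le_iff₀ (Nat.cast_pos.mpr Q.card_pos), ← nsmul_eq_mul, Nat.card_eq_fintype_card]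
  exact (norm_sum_le _ _).trans (Finset.sum_le_card_nsmul _ _ _ hτ)

theorem differentiableOn_comp_of_mem_G {F : Cn n → ℂ} (hF : DifferentiableOn ℂ F Q.X)
    {τ : Cn n ≃ₗᵢ[ℂ] Cn n} (hτ : τ ∈ Q.G) : DifferentiableOn ℂ (fun z => F (τ z)) Q.X :=
  hF.comp τ.toContinuousLinearEquiv.differentiable.differentiableOn (Q.invariant_X τ hτ)

theorem differentiableOn_average {F : Cn n → ℂ} (hF : DifferentiableOn ℂ F Q.X) :
    DifferentiableOn ℂ (Q.average F) Q.X :=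
  (DifferentiableOn.fun_sum fun τ _ => Q.differentiableOn_comp_of_mem_G hF τ.2).const_mul _

/-- The averaging operator on `L²(Γ_X)`. -/
noncomputable def averageL (ψ : Lp ℂ 2 Q.σ) : Lp ℂ 2 Q.σ :=
  (Nat.card Q.G : ℂ)⁻¹ •
    ∑ τ : Q.G, Lp.compMeasurePreservingₗᵢ ℂ τ.1 (Q.measurePreserving_G τ.2) ψ

theorem coeFn_averageL (ψ : Lp ℂ 2 Q.σ) : Q.averageL ψ =ᵐ[Q.σ] Q.average ψ := by
  have hcomp : ∀ᵐ z ∂Q.σ, ∀ τ : Q.G,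
      Lp.compMeasurePreservingₗᵢ ℂ τ.1 (Q.measurePreserving_G τ.2) ψ z = ψ (τ.1 z) :=
    ae_all_iff.mpr fun τ => Lp.coeFn_compMeasurePreserving ψ (Q.measurePreserving_G τ.2)
  filter_upwards [hcomp, Lp.coeFn_smul (Nat.card Q.G : ℂ)⁻¹
    (∑ τ : Q.G, Lp.compMeasurePreservingₗᵢ ℂ τ.1 (Q.measurePreserving_G τ.2) ψ),
    Lp.coeFn_fun_finsetSum Finset.univ fun τ : Q.G =>
      Lp.compMeasurePreservingₗᵢ ℂ τ.1 (Q.measurePreserving_G τ.2) ψ] with z hτ hsmul hsum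
  rw [averageL, hsmul, Pi.smul_apply, hsum, average, smul_eq_mul]
  simp only [hτ]

theorem isInvariantΓ_averageL (ψ : Lp ℂ 2 Q.σ) : Q.IsInvariantΓ (Q.averageL ψ) := by
  intro τ hτ
  filter_upwards [Q.coeFn_averageL ψ,
    (Q.measurePreserving_G hτ).quasiMeasurePreserving.ae (Q.coeFn_averageL ψ)] with z hz hτz
  rw [hz, hτz, Q.average_apply _ hτ]

theorem inner_averageL {φ : Lp ℂ 2 Q.σ} (hφ : Q.IsInvariantΓ φ) (ψ : Lp ℂ 2 Q.σ) :
    inner ℂ φ (Q.averageL ψ) = inner ℂ φ ψ := by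
  have hinner : ∀ τ : Q.G,
      inner ℂ φ (Lp.compMeasurePreservingₗᵢ ℂ τ.1 (Q.measurePreserving_G τ.2) ψ) = inner ℂ φ ψ := by
    intro τ
    have hτφ : Lp.compMeasurePreservingₗᵢ ℂ τ.1 (Q.measurePreserving_G τ.2) φ = φ :=
      Lp.ext ((Lp.coeFn_compMeasurePreserving φ (Q.measurePreserving_G τ.2)).trans (hφ τ.1 τ.2))
    conv_lhs => rw [← hτφ]
    exact LinearIsometry.inner_map_map _ _ _
  rw [averageL, inner_smul_right, inner_sum, Finset.sum_congr rfl fun τ _ => hinner τ,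
    Q.card_inv_mul_sum_const]

theorem averageL_eq_self {ψ : Lp ℂ 2 Q.σ} (hψ : Q.IsInvariantΓ ψ) : Q.averageL ψ = ψ := by
  refine Lp.ext ?_
  filter_upwards [Q.coeFn_averageL ψ,
    ae_all_iff.mpr fun τ : Q.G => hψ τ.1 τ.2] with z hz hinv
  rw [hz, average, Finset.sum_congr rfl fun τ _ => hinv τ, Q.card_inv_mul_sum_const]

/-- The function `|G|^{-1/2} (f ∘ Φ) g` on `X` which corresponds to the function `f` on `Ω`. -/
noncomputable def pullback (g f : Cn n → ℂ) (z : Cn n) : ℂ :=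
  Q.normConst * (f (Q.Φ z) * g z)

end

variable {n : ℕ} {Q : QuotientQuadruple n} {w : Cn n → ℝ} {g gs : Cn n → ℂ}

theorem isBoundaryX_average {F ψ : Cn n → ℂ} (h : Q.IsBoundaryX F ψ) :
    Q.IsBoundaryX (Q.average F) (Q.average ψ) := by
  have hτ : ∀ᵐ z ∂Q.σ, ∀ τ : Q.G, HasBoundaryValue F (τ.1 z) (ψ (τ.1 z)) :=
    ae_all_iff.mpr fun τ => (Q.measurePreserving_G τ.2).quasiMeasurePreserving.ae h
  filter_upwards [hτ] with z hz
  refine Tendsto.const_mul _ (tendsto_finsetSum _ fun τ _ => ?_)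
  simpa only [HasBoundaryValue, map_smul] using hz τ

theorem memWeightedHardyX_two {F : Cn n → ℂ} : Q.MemWeightedHardyX g 2 F ↔ Q.MemHardyX 2 F := by
  simp [MemWeightedHardyX, MemHardyX]

theorem MemWeightedHardyX.congr {p : ℝ} {F F' : Cn n → ℂ} (h : Q.MemWeightedHardyX g p F)
    (hF : EqOn F F' Q.X) : Q.MemWeightedHardyX g p F' := by
  refine ⟨h.1.congr hF.symm, ?_⟩
  refine (iSup₂_mono fun r hr => (lintegral_congr_ae ?_).le).trans_lt h.2
  filter_upwards [Q.ae_mem_Γ] with z hz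
  rw [hF (Q.smul_mem hz hr)]

theorem lintegral_comp_of_mem_G (hg : ∀ τ ∈ Q.G, ∀ z ∈ Q.X, g (τ z) = g z)
    {τ : Cn n ≃ₗᵢ[ℂ] Cn n} (hτ : τ ∈ Q.G) (F : Cn n → ℂ) (p q : ℝ) {r : ℝ}
    (hr : r ∈ Ioo (0 : ℝ) 1) :
    ∫⁻ z, ‖F (τ ((r : ℂ) • z))‖ₑ ^ p * ‖g ((r : ℂ) • z)‖ₑ ^ q ∂Q.σ
      = ∫⁻ z, ‖F ((r : ℂ) • z)‖ₑ ^ p * ‖g ((r : ℂ) • z)‖ₑ ^ q ∂Q.σ := by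
  rw [← (Q.measurePreserving_G hτ).lintegral_comp_emb τ.toHomeomorph.measurableEmbedding
    fun z => ‖F ((r : ℂ) • z)‖ₑ ^ p * ‖g ((r : ℂ) • z)‖ₑ ^ q]
  refine lintegral_congr_ae ?_
  filter_upwards [Q.ae_mem_Γ] with z hz
  rw [← hg τ hτ _ (Q.smul_mem hz hr), map_smul]

theorem MemWeightedHardyX.average (hg : Q.IsAdmissible w g) {p : ℝ} (hp : 0 ≤ p) {F : Cn n → ℂ}
    (h : Q.MemWeightedHardyX g p F) : Q.MemWeightedHardyX g p (Q.average F) := by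
  refine ⟨Q.differentiableOn_average h.1, ?_⟩
  set A := ⨆ r ∈ Ioo (0 : ℝ) 1,
    ∫⁻ z, ‖F ((r : ℂ) • z)‖ₑ ^ p * ‖g ((r : ℂ) • z)‖ₑ ^ (2 - p) ∂Q.σ
  have hA : ∑ _τ : Q.G, A < ⊤ := ENNReal.sum_lt_top.mpr fun _ _ => h.2
  refine (iSup₂_le fun r hr => ?_).trans_lt hA
  calc ∫⁻ z, ‖Q.average F ((r : ℂ) • z)‖ₑ ^ p * ‖g ((r : ℂ) • z)‖ₑ ^ (2 - p) ∂Q.σ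
      ≤ ∫⁻ z, ∑ τ : Q.G,
          ‖F (τ.1 ((r : ℂ) • z))‖ₑ ^ p * ‖g ((r : ℂ) • z)‖ₑ ^ (2 - p) ∂Q.σ := by
        refine lintegral_mono fun z => ?_
        obtain ⟨τ, hτ⟩ := Q.exists_norm_average_le F ((r : ℂ) • z)
        refine le_trans ?_ (Finset.single_le_sum (fun _ _ => zero_le) (Finset.mem_univ τ))
        gcongr
        exact enorm_le_iff_norm_le.mpr hτ
    _ = ∑ τ : Q.G,
          ∫⁻ z, ‖F (τ.1 ((r : ℂ) • z))‖ₑ ^ p * ‖g ((r : ℂ) • z)‖ₑ ^ (2 - p) ∂Q.σ :=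
        lintegral_finsetSum' _ fun τ _ =>
          ((Q.aemeasurable_dilate (F := fun z => F (τ.1 z))
            (Q.differentiableOn_comp_of_mem_G h.1 τ.2).continuousOn hr).enorm.pow_const _).mul
          ((Q.aemeasurable_dilate hg.holomorphic.continuousOn hr).enorm.pow_const _)
    _ ≤ ∑ _τ : Q.G, A := by
        gcongr with τ
        rw [lintegral_comp_of_mem_G hg.invariant τ.2 F p (2 - p) hr]
        exact le_iSup₂ (f := fun r (_ : r ∈ Ioo (0 : ℝ) 1) =>
          ∫⁻ z, ‖F ((r : ℂ) • z)‖ₑ ^ p * ‖g ((r : ℂ) • z)‖ₑ ^ (2 - p) ∂Q.σ) r hr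

end QuotientQuadruple

namespace QuotientQuadruple

variable {n : ℕ} {Q : QuotientQuadruple n} {w : Cn n → ℝ} {g gs : Cn n → ℂ}

theorem lintegral_pullback (hg : ∀ z ∈ Q.X, g z ≠ 0) {p : ℝ} (hp : 0 ≤ p) (f : Cn n → ℂ) {r : ℝ}
    (hr : r ∈ Ioo (0 : ℝ) 1) :
    ∫⁻ z, ‖Q.pullback g f ((r : ℂ) • z)‖ₑ ^ p * ‖g ((r : ℂ) • z)‖ₑ ^ (2 - p) ∂Q.σ
      = ‖Q.normConst‖ₑ ^ p *
        ∫⁻ z, ‖f (Q.Φ ((r : ℂ) • z))‖ₑ ^ p * ‖g ((r : ℂ) • z)‖ₑ ^ (2 : ℝ) ∂Q.σ := by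
  rw [← lintegral_const_mul' _ _ (ENNReal.rpow_ne_top_of_nonneg hp enorm_ne_top)]
  refine lintegral_congr_ae ?_
  filter_upwards [Q.ae_mem_Γ] with z hz
  have h0 : ‖g ((r : ℂ) • z)‖ₑ ≠ 0 := enorm_ne_zero.mpr (hg _ (Q.smul_mem hz hr))
  rw [pullback, enorm_mul, enorm_mul, ENNReal.mul_rpow_of_nonneg _ _ hp,
    ENNReal.mul_rpow_of_nonneg _ _ hp, mul_assoc, mul_assoc,
    ← ENNReal.rpow_add _ _ h0 enorm_ne_top, add_sub_cancel]

theorem memWeightedHardyX_pullback_iff (hg : Q.IsAdmissible w g) {p : ℝ} (hp : 0 ≤ p)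
    {f : Cn n → ℂ} (hf : DifferentiableOn ℂ f Q.Ω) :
    Q.MemWeightedHardyX g p (Q.pullback g f) ↔ Q.MemHardyΩ g p f := by
  have hd : DifferentiableOn ℂ (Q.pullback g f) Q.X :=
    ((hf.comp Q.holomorphic_Φ fun z hz => Q.Φ_mem hz).mul hg.holomorphic).const_mul _
  have hc : ‖Q.normConst‖ₑ ^ p ≠ ⊤ := ENNReal.rpow_ne_top_of_nonneg hp enorm_ne_top
  have hint := iSup_congr fun r => iSup_congr fun hr : r ∈ Ioo (0 : ℝ) 1 =>
    lintegral_pullback hg.ne_zero hp f hr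
  rw [MemWeightedHardyX, MemHardyΩ, and_iff_right hd, and_iff_right hf, hint]
  simp_rw [← ENNReal.mul_iSup]
  constructor <;> intro h
  · exact ENNReal.mul_lt_top Q.card_inv_ne_top.lt_top
      (ENNReal.lt_top_of_mul_ne_top_right h.ne (Q.enorm_normConst_rpow_ne_zero hp))
  · exact ENNReal.mul_lt_top hc.lt_top
      (ENNReal.lt_top_of_mul_ne_top_right h.ne Q.card_inv_ne_zero)

theorem memHardyX_two_pullback (hg : Q.IsAdmissible w g) {f : Cn n → ℂ} (hf : Q.MemHardyΩ g 2 f) :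
    Q.MemHardyX 2 (Q.pullback g f) :=
  memWeightedHardyX_two.mp ((memWeightedHardyX_pullback_iff hg zero_le_two hf.1).mpr hf)

theorem exists_eqOn_average_pullback (hg : Q.IsAdmissible w g) {F : Cn n → ℂ}
    (hF : DifferentiableOn ℂ F Q.X) :
    ∃ f, DifferentiableOn ℂ f Q.Ω ∧ EqOn (Q.average F) (Q.pullback g f) Q.X := by
  have hd : DifferentiableOn ℂ (fun z => Q.average F z * (Q.normConst * g z)⁻¹) Q.X :=
    (Q.differentiableOn_average hF).mul ((hg.holomorphic.const_mul _).inv fun z hz =>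
      mul_ne_zero Q.normConst_ne_zero (hg.ne_zero z hz))
  have hinv : ∀ τ ∈ Q.G, ∀ z ∈ Q.X, Q.average F (τ z) * (Q.normConst * g (τ z))⁻¹
      = Q.average F z * (Q.normConst * g z)⁻¹ := fun τ hτ z hz => by
    rw [Q.average_apply _ hτ, hg.invariant τ hτ z hz]
  refine ⟨_, Q.differentiableOn_descend hd hinv, fun z hz => ?_⟩
  have hc := Q.normConst_ne_zero
  have hgz := hg.ne_zero z hz
  rw [pullback, Q.descend_Φ hinv hz]
  field_simp

namespace IsBoundaryDatum

theorem isBoundaryX_pullback_iff (h : Q.IsBoundaryDatum w g gs) {f φ : Cn n → ℂ} :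
    Q.IsBoundaryX (Q.pullback g f) (Q.lift gs φ) ↔ Q.IsBoundaryΩ f φ := by
  constructor
  · intro hF
    refine ⟨φ, EventuallyEq.rfl, ?_⟩
    filter_upwards [hF, h.boundary, h.ae_ne_zero, Q.ae_mem_Γ] with z hFz hgz hgs hz
    have hquot := (hFz.div_const Q.normConst).div hgz hgs
    rw [lift, mul_div_cancel_left₀ _ Q.normConst_ne_zero, mul_div_cancel_right₀ _ hgs,
      Q.boundaryMap_eq hz] at hquot
    refine hquot.congr' ?_
    filter_upwards [Q.eventually_smul_mem_X hz] with r hr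
    rw [Pi.div_apply, pullback, mul_div_cancel_left₀ _ Q.normConst_ne_zero,
      mul_div_cancel_right₀ _ (h.admissible.ne_zero _ hr), Function.comp_apply]
  · rintro ⟨u, hu, hf⟩
    filter_upwards [hf, h.boundary, Q.ae_mem_Γ,
      h.quasiMeasurePreserving_boundaryMap.ae hu] with z hfz hgz hz huφ
    rw [lift, ← huφ, Q.boundaryMap_eq hz]
    exact (hfz.mul hgz).const_mul _

theorem isBoundaryX_pullback_liftL (h : Q.IsBoundaryDatum w g gs) {f : Cn n → ℂ}
    {φ : Lp ℂ 2 Q.m} (hf : Q.IsBoundaryΩ f φ) : Q.IsBoundaryX (Q.pullback g f) (h.liftL φ) := by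
  filter_upwards [h.isBoundaryX_pullback_iff.mpr hf, h.coeFn_liftL φ] with z hz hlift
  rwa [hlift]

theorem liftL_mem_hardySubspaceX (h : Q.IsBoundaryDatum w g gs) {φ : Lp ℂ 2 Q.m}
    (hφ : φ ∈ Q.hardySubspaceΩ g h.admissible.holomorphic.continuousOn) :
    h.liftL φ ∈ Q.hardySubspaceX := by
  obtain ⟨f, hf, hfφ⟩ := hφ
  exact ⟨Q.pullback g f, memHardyX_two_pullback h.admissible hf, h.isBoundaryX_pullback_liftL hfφ⟩

theorem exists_isBoundaryΩ (h : Q.IsBoundaryDatum w g gs) {F : Cn n → ℂ} {ψ : Lp ℂ 2 Q.σ}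
    (hF : DifferentiableOn ℂ F Q.X) (hψ : Q.IsBoundaryX F ψ) {η : Lp ℂ 2 Q.m}
    (hη : h.liftL η = Q.averageL ψ) :
    ∃ f, Q.IsBoundaryΩ f η ∧
      ∀ p : ℝ, 0 ≤ p → Q.MemWeightedHardyX g p F → Q.MemHardyΩ g p f := by
  obtain ⟨f, hf, hfF⟩ := exists_eqOn_average_pullback h.admissible hF
  refine ⟨f, h.isBoundaryX_pullback_iff.mp ?_, fun p hp hFp =>
    (memWeightedHardyX_pullback_iff h.admissible hp hf).mp
      ((hFp.average h.admissible hp).congr hfF)⟩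
  filter_upwards [isBoundaryX_average hψ, Q.coeFn_averageL ψ, h.coeFn_liftL η, Q.ae_mem_Γ]
    with z hbdry haverage hlift hz
  rw [← hlift, hη, haverage]
  refine hbdry.congr' ?_
  filter_upwards [Q.eventually_smul_mem_X hz] with r hr using hfF hr

theorem sub_szegoΩ_mem_orthogonal (h : Q.IsBoundaryDatum w g gs) (φ : Lp ℂ 2 Q.m) :
    h.liftL (φ - Q.szegoΩ g h.admissible.holomorphic.continuousOn φ) ∈ Q.hardySubspaceXᗮ := by
  set K := Q.hardySubspaceΩ g h.admissible.holomorphic.continuousOn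
  have horth : φ - K.topologicalClosure.starProjection φ ∈ Kᗮ := by
    rw [← Submodule.orthogonal_closure]
    exact Submodule.sub_starProjection_mem_orthogonal _
  rw [Submodule.mem_orthogonal']
  rintro ψ ⟨F, hF, hψ⟩
  obtain ⟨η, hη⟩ := h.exists_liftL_eq (Q.isInvariantΓ_averageL ψ)
  obtain ⟨f, hfη, hf⟩ := h.exists_isBoundaryΩ hF.1 hψ hη
  rw [← Q.inner_averageL (h.isInvariantΓ_liftL _), ← hη, h.liftL.inner_map_map]
  exact (Submodule.mem_orthogonal' _ _).mp horth η
    ⟨f, hf 2 zero_le_two (memWeightedHardyX_two.mpr hF), hfη⟩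

theorem szegoX_liftL (h : Q.IsBoundaryDatum w g gs) (φ : Lp ℂ 2 Q.m) :
    Q.szegoX (h.liftL φ) = h.liftL (Q.szegoΩ g h.admissible.holomorphic.continuousOn φ) := by
  refine Submodule.eq_starProjection_of_mem_orthogonal ?_ ?_
  · have hmem : Q.szegoΩ g h.admissible.holomorphic.continuousOn φ ∈
        (Q.hardySubspaceΩ g h.admissible.holomorphic.continuousOn).topologicalClosure :=
      Submodule.starProjection_apply_mem _ φ
    exact MapsTo.closure (fun χ hχ => h.liftL_mem_hardySubspaceX hχ) h.liftL.continuous hmem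
  · rw [Submodule.orthogonal_closure, ← map_sub]
    exact h.sub_szegoΩ_mem_orthogonal φ

theorem szegoΩBounded_iff (h : Q.IsBoundaryDatum w g gs) {p : ℝ} (hp : 0 < p) :
    Q.SzegoΩBounded g h.admissible.holomorphic.continuousOn p ↔ Q.SzegoXBoundedOnInvariant w p := by
  refine exists_congr fun C => ⟨fun hC ψ hψ hψp => ?_, fun hC φ hφ => ?_⟩
  · obtain ⟨φ, rfl⟩ := h.exists_liftL_eq hψ
    rw [h.szegoX_liftL, h.eLpNorm_liftL hp, h.eLpNorm_liftL hp, mul_left_comm]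
    gcongr
    exact hC φ ((h.memLp_liftL_iff hp φ).mp hψp)
  · have hlift := hC (h.liftL φ) (h.isInvariantΓ_liftL φ) ((h.memLp_liftL_iff hp φ).mpr hφ)
    rwa [h.szegoX_liftL, h.eLpNorm_liftL hp, h.eLpNorm_liftL hp, mul_left_comm,
      ENNReal.mul_le_mul_iff_right (Q.normRatio_ne_zero hp) (Q.normRatio_ne_top hp)] at hlift

theorem szegoΩMapsToHardy_iff (h : Q.IsBoundaryDatum w g gs) {p : ℝ} (hp : 0 < p) :
    Q.SzegoΩMapsToHardy g h.admissible.holomorphic.continuousOn p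
      ↔ Q.SzegoXMapsInvariantToHardy w g p := by
  refine ⟨fun hΩ ψ hψ hψp => ?_, fun hX φ hφ => ?_⟩
  · obtain ⟨φ, rfl⟩ := h.exists_liftL_eq hψ
    obtain ⟨f, hf2, hfp, hfφ⟩ := hΩ φ ((h.memLp_liftL_iff hp φ).mp hψp)
    refine ⟨Q.pullback g f, memHardyX_two_pullback h.admissible hf2,
      (memWeightedHardyX_pullback_iff h.admissible hp.le hf2.1).mpr hfp, ?_⟩
    rw [h.szegoX_liftL]
    exact h.isBoundaryX_pullback_liftL hfφ
  · obtain ⟨F, hF2, hFp, hFφ⟩ :=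
      hX (h.liftL φ) (h.isInvariantΓ_liftL φ) ((h.memLp_liftL_iff hp φ).mpr hφ)
    rw [h.szegoX_liftL] at hFφ
    obtain ⟨f, hfφ, hf⟩ := h.exists_isBoundaryΩ hF2.1 hFφ
      (Q.averageL_eq_self (h.isInvariantΓ_liftL _)).symm
    exact ⟨f, hf 2 zero_le_two (memWeightedHardyX_two.mpr hF2), hf p hp.le hFp, hfφ⟩

end IsBoundaryDatum

end QuotientQuadruple

theorem mainTheorem4_general (n : ℕ) (Q : QuotientQuadruple n)
    (w : Cn n → ℝ) (hw : Q.IsPullbackDensity w)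
    (g : Cn n → ℂ) (hg : Q.IsAdmissible w g)
    (p : ℝ) (hp : 0 < p) :
    (Q.SzegoΩBounded g hg.holomorphic.continuousOn p ↔ Q.SzegoXBoundedOnInvariant w p) ∧
    ((Q.SzegoΩBounded g hg.holomorphic.continuousOn p ∧
        Q.SzegoΩMapsToHardy g hg.holomorphic.continuousOn p) ↔
      (Q.SzegoXBoundedOnInvariant w p ∧ Q.SzegoXMapsInvariantToHardy w g p)) := by
  obtain ⟨gs, h⟩ := Q.exists_isBoundaryDatum hw hg
  have hbounded := h.szegoΩBounded_iff hp
  exact ⟨hbounded, and_congr hbounded (h.szegoΩMapsToHardy_iff hp)⟩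

theorem mainTheorem4 (n : ℕ) (hn : 0 < n) (Q : QuotientQuadruple n)
    (w : Cn n → ℝ) (hw : Q.IsPullbackDensity w)
    (g : Cn n → ℂ) (hg : Q.IsAdmissible w g)
    (p : ℝ) (hp : 1 < p) :
    (Q.SzegoΩBounded g hg.holomorphic.continuousOn p ↔ Q.SzegoXBoundedOnInvariant w p) ∧
    ((Q.SzegoΩBounded g hg.holomorphic.continuousOn p ∧
        Q.SzegoΩMapsToHardy g hg.holomorphic.continuousOn p) ↔
      (Q.SzegoXBoundedOnInvariant w p ∧ Q.SzegoXMapsInvariantToHardy w g p)) :=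
  mainTheorem4_general n Q w hw g hg p (zero_lt_one.trans hp)
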